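/- Let $\mathcal L=\{\subseteq,\bot,\mathrm{At},\lhd\}$ be the first order language with binary relation symbols $\subseteq,\lhd$, a constant $\bot$ and a unary relation symbol $\mathrm{At}$. Lower case variables range over elements satisfying $\mathrm{At}$ (atoms), and $X(x)$ abbreviates $x\subseteq X$. Let $T_{\mathrm{MSO(Fin)}}$ be the $\mathcal L$-theory with axioms saying: $\subseteq$ is the order of an atomic Boolean algebra (possibly the one-element one) with least element $\bot$; $\mathrm{At}$ holds exactly of its atoms; $\lhd$ is a strict linear order on the atoms, and $X\lhd Y$ holds iff $x\lhd y$ for some atoms $x\subseteq X$, $y\subseteq Y$; comprehension $\forall\bar Y\,\exists X\,\forall x\,(X(x)\leftrightarrow\eta(x;\bar Y))$ for every $\mathcal L$-formula $\eta$; the order of the atoms, if non-empty, is discrete with first and last element (every atom but the last has an immediate successor, every atom but the first an immediate predecessor); every element other than $\bot$ contains a smallest atom. Let $\mathrm{LT}$ be the Lindenbaum–Tarski algebra of $T_{\mathrm{MSO(Fin)}}$, i.e. the Boolean algebra of $\mathcal L$-sentences modulo equivalence over $T_{\mathrm{MSO(Fin)}}$. Define $+$ on $\mathrm{LT}$ by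 letting $[\varphi]+[\psi]$ be the class of $$\exists X\,\bigl(\forall x\,\forall y\,(X(x)\wedge y\lhd x\to X(y))\ \wedge\ \varphi^{X}\wedge\psi^{X^c}\bigr),$$ where $\varphi^{A}$ denotes $\varphi$ with quantifiers relativised to the elements below $A$ and $X^c$ is the complement of $X$. Let $S_0$ be the space of completions of $T_{\mathrm{MSO(Fin)}}$, with the sets $\langle\varphi\rangle=\{x:\varphi\in x\}$ as a basis of open sets. For models $M,N$ of $T_{\mathrm{MSO(Fin)}}$ let $M\otimes N$ be the $\mathcal L$-structure on $M\times N$ in which $\subseteq$ is the product order, $\bot$ and $\mathrm{At}$ are its bottom element and its atoms, and $(A,B)\lhd(C,D)$ iff ($A\ne\bot$ and $D\ne\bot$) or $A\lhd C$ or $B\lhd D$. **Theorem.** The operation $+$ on $\mathrm{LT}$ is normal ($a+\bot=\bot+a=\bot$) and additive (it preserves binary joins in each argument). Putting $x\otimes y=\mathrm{Th}(M\otimes N)$, for any $M\models x$ and $N\models y$, gives a well-defined binary operation on $S_0$, and $(S_0,\otimes)$ is the extended Stone dual of $(\mathrm{LT},+)$. That is: $S_0$ is a Boolean space (compact, Hausdorff,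 totally disconnected), and $x\mapsto\{[\varphi]:\varphi\in x\}$ is a homeomorphism from $S_0$ onto the space of prime filters of $\mathrm{LT}$; the graph of $\otimes$ is a compatible ternary relation on $S_0$ (for clopen $A,B$ the set $\{x\otimes y:x\in A,\ y\in B\}$ is clopen, and for each $z$ the set $\{(x,y):x\otimes y=z\}$ is closed in $S_0\times S_0$); and, identifying $x\in S_0$ with its prime filter and writing $x\,\hat+\,y=\{a+b:a\in x,\ b\in y\}$, for all $x,y,z\in S_0$ $$R_+(x,y,z)\ :\Longleftrightarrow\ x\,\hat+\,y\subseteq z\qquad\text{holds if and only if}\qquad z=x\otimes y.$$ In particular the dual is functional: for all prime filters $x,y$ of $\mathrm{LT}$ there is exactly one prime filter $z$ with $x\,\hat+\,y\subseteq z$. Moreover the filter of $\mathrm{LT}$ generated by $x\,\hat+\,y$ equals $x\otimes y$. -/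

import Mathlib

open FirstOrder FirstOrder.Language

namespace PseudofiniteMSO

universe u v w

/-! ### The language -/

/-- The only function symbol: the constant for the bottom element. -/
inductive MSOFunc : ℕ → Type
  | bot : MSOFunc 0

/-- The relation symbols: inclusion, being an atom, and the relation
"some atom of the first is strictly before some atom of the second". -/
inductive MSORel : ℕ → Type
  | sub : MSORel 2
  | atom : MSORel 1
  | prec : MSORel 2

/-- The one-sorted first order language for monadic second order logic of linear orders. -/
def msoLang : FirstOrder.Language.{0, 0} := ⟨MSOFunc, MSORel⟩

section Formulas

variable {α : Type} {n : ℕ}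

/-- The innermost (most recently quantified) variable. -/
def new : α ⊕ Fin (n + 1) := Sum.inr (Fin.last n)

/-- A variable, seen under one more quantifier. -/
def up (s : α ⊕ Fin n) : α ⊕ Fin (n + 1) := Sum.map id Fin.castSucc s

/-- The formula `s ⊆ t`. -/
def subF (s t : α ⊕ Fin n) : msoLang.BoundedFormula α n :=
  Relations.boundedFormula₂ (L := msoLang) MSORel.sub (Term.var s) (Term.var t)

/-- The formula `At(s)`. -/
def atomF (s : α ⊕ Fin n) : msoLang.BoundedFormula α n :=
  Relations.boundedFormula₁ (L := msoLang) MSORel.atom (Term.var s)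

/-- The formula `s ◁ t`. -/
def precF (s t : α ⊕ Fin n) : msoLang.BoundedFormula α n :=
  Relations.boundedFormula₂ (L := msoLang) MSORel.prec (Term.var s) (Term.var t)

/-- The formula `s = t`. -/
def eqF (s t : α ⊕ Fin n) : msoLang.BoundedFormula α n :=
  Term.bdEqual (Term.var s) (Term.var t)

/-- The formula `s = ⊥`. -/
def botF (s : α ⊕ Fin n) : msoLang.BoundedFormula α n :=
  Term.bdEqual (Term.var s) (Constants.term (L := msoLang) MSOFunc.bot)

/-- Quantification over atoms (the lower case variables of monadic second order logic). -/
def allAtom (φ : msoLang.BoundedFormula α (n + 1)) : msoLang.BoundedFormula α n :=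
  ((atomF new).imp φ).all

/-- Existential quantification over atoms. -/
def exAtom (φ : msoLang.BoundedFormula α (n + 1)) : msoLang.BoundedFormula α n :=
  (atomF new ⊓ φ).ex

/-- `z` is the infimum of `x` and `y`. -/
def infF (z x y : α ⊕ Fin n) : msoLang.BoundedFormula α n :=
  (subF z x ⊓ subF z y) ⊓
    ((subF new (up x) ⊓ subF new (up y)).imp (subF new (up z))).all

/-- `z` is the supremum of `x` and `y`. -/
def supF (z x y : α ⊕ Fin n) : msoLang.BoundedFormula α n :=
  (subF x z ⊓ subF y z) ⊓
    ((subF (up x) new ⊓ subF (up y) new).imp (subF (up z) new)).all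

/-- `x` and `y` are complements of each other: only `⊥` is below both,
and whatever is above both is the top element. -/
def complF (x y : α ⊕ Fin n) : msoLang.BoundedFormula α n :=
  ((subF new (up x) ⊓ subF new (up y)).imp (botF new)).all ⊓
    ((subF (up x) new ⊓ subF (up y) new).imp (subF new (up new)).all).all

/-- `x` is downward closed with respect to the ordering of the atoms. -/
def dwclF (x : α ⊕ Fin n) : msoLang.BoundedFormula α n :=
  allAtom (allAtom
    ((subF (up new) (up (up x)) ⊓ precF new (up new)).imp (subF new (up (up x)))))

/-- The `i`-th variable (counting from the outermost quantifier) of a formula without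
free variables. -/
abbrev b (i : Fin n) : Empty ⊕ Fin n := Sum.inr i

end Formulas

/-! ### The theories -/

/-- Axioms: `⊆` is the order of a (possibly degenerate) Boolean algebra, i.e. of a complemented
distributive lattice with least element `⊥` and a greatest element. -/
inductive BooleanAx : msoLang.Sentence → Prop
  | refl : BooleanAx (subF (b 0) (b 0)).all
  | trans : BooleanAx
      ((subF (b 0) (b 1) ⊓ subF (b 1) (b 2)).imp (subF (b 0) (b 2))).all.all.all
  | antisymm : BooleanAx
      ((subF (b 0) (b 1) ⊓ subF (b 1) (b 0)).imp (eqF (b 0) (b 1))).all.all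
  | bot : BooleanAx ((botF (b 0)).imp (subF (b 0) (b 1))).all.all
  | top : BooleanAx (subF (b 1) (b 0)).all.ex
  | inf : BooleanAx (infF (b 2) (b 0) (b 1)).ex.all.all
  | sup : BooleanAx (supF (b 2) (b 0) (b 1)).ex.all.all
  -- if `j = y ∨ z`, `p = x ∧ j`, `q = x ∧ y`, `r = x ∧ z` then `p = q ∨ r`,
  -- where `x, y, z, j, p, q, r` are the variables `0, …, 6`
  | distrib : BooleanAx
      ((supF (b 3) (b 1) (b 2) ⊓ infF (b 4) (b 0) (b 3) ⊓ infF (b 5) (b 0) (b 1) ⊓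
        infF (b 6) (b 0) (b 2)).imp (supF (b 4) (b 5) (b 6))).all.all.all.all.all.all.all
  | compl : BooleanAx (complF (b 0) (b 1)).ex.all

/-- The comprehension axiom `∀ Ȳ ∃ X ∀ x (X(x) ↔ η(x; Ȳ))`, the quantifier `∀ x` ranging over
atoms. In `η` the variable `x` is `Sum.inr ()` and the parameters `Ȳ` are `Sum.inl i`. -/
def compAx {k : ℕ} (η : msoLang.Formula (Fin k ⊕ Unit)) : msoLang.Sentence :=
  (allAtom ((subF (α := Empty) (n := k + 2) new (up new)).iff
    (BoundedFormula.relabel (n := k + 2) (k := 0)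
      (Sum.elim (fun i => up (up (Sum.inr i))) (fun _ => new)) η))).ex.alls

/-- The theory `T_base`. -/
inductive BaseAx : msoLang.Sentence → Prop
  | boolean {φ : msoLang.Sentence} : BooleanAx φ → BaseAx φ
  -- `At` holds precisely for the atoms
  | atom : BaseAx ((atomF (b 0)).iff ((botF (b 0)).not ⊓
      ((subF (b 1) (b 0)).imp (botF (b 1) ⊔ eqF (b 1) (b 0))).all)).all
  -- the Boolean algebra is atomic
  | atomic : BaseAx ((botF (b 0)).not.imp (exAtom (subF (b 1) (b 0)))).all
  -- the atoms are (strictly) linearly ordered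
  | irrefl : BaseAx (allAtom (precF (b 0) (b 0)).not)
  | trans : BaseAx (allAtom (allAtom (allAtom
      ((precF (b 0) (b 1) ⊓ precF (b 1) (b 2)).imp (precF (b 0) (b 2))))))
  | total : BaseAx (allAtom (allAtom
      (precF (b 0) (b 1) ⊔ (eqF (b 0) (b 1) ⊔ precF (b 1) (b 0)))))
  -- the ordering of the atoms determines the whole relation
  | prec : BaseAx ((precF (b 0) (b 1)).iff (exAtom (exAtom
      (subF (b 2) (b 0) ⊓ (subF (b 3) (b 1) ⊓ precF (b 2) (b 3)))))).all.all
  | comp {k : ℕ} (η : msoLang.Formula (Fin k ⊕ Unit)) : BaseAx (compAx η)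

/-- The further axioms of `T_MSO(Fin)`. The empty order counts as discrete with endpoints. -/
inductive FinAx : msoLang.Sentence → Prop
  | base {φ : msoLang.Sentence} : BaseAx φ → FinAx φ
  -- if there are atoms, there is a first and a last one
  | first : FinAx ((exAtom (eqF (b 0) (b 0))).imp
      (exAtom (allAtom (precF (b 1) (b 0)).not)))
  | last : FinAx ((exAtom (eqF (b 0) (b 0))).imp
      (exAtom (allAtom (precF (b 0) (b 1)).not)))
  -- an atom that is not the last one has an immediate successor
  | succ : FinAx (allAtom ((exAtom (precF (b 0) (b 1))).imp
      (exAtom (precF (b 0) (b 1) ⊓ (allAtom (precF (b 0) (b 2) ⊓ precF (b 2) (b 1)).not)))))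
  -- an atom that is not the first one has an immediate predecessor
  | pred : FinAx (allAtom ((exAtom (precF (b 1) (b 0))).imp
      (exAtom (precF (b 1) (b 0) ⊓ (allAtom (precF (b 1) (b 2) ⊓ precF (b 2) (b 0)).not)))))
  -- every non-bottom element contains a smallest atom
  | least : FinAx ((botF (b 0)).not.imp (exAtom (subF (b 1) (b 0) ⊓
      allAtom ((precF (b 2) (b 1)).imp (subF (b 2) (b 0)).not)))).all

/-- The theory `T_base`. -/
def TBase : msoLang.Theory := {φ | BaseAx φ}

/-- The theory `T_MSO(Fin)`. -/
def TFin : msoLang.Theory := {φ | FinAx φ}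

/-! ### Semantics of the axioms -/

section Semantics

@[simp] theorem elim_new {M : Type w} {α : Type} {n : ℕ} {e : α → M} {xs : Fin n → M} {a : M} :
    (Sum.elim e (Fin.snoc xs a : Fin (n + 1) → M)) new = a := by
  simp [new]

@[simp] theorem elim_up {M : Type w} {α : Type} {n : ℕ} {e : α → M} {xs : Fin n → M} {a : M}
    (s : α ⊕ Fin n) :
    (Sum.elim e (Fin.snoc xs a : Fin (n + 1) → M)) (up s) = Sum.elim e xs s := by
  rcases s with s | s <;> simp [up]

variable {M : Type w} [msoLang.Structure M]

/-- The interpretation of `⊆`. -/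
def Sub (x y : M) : Prop := Structure.RelMap (L := msoLang) MSORel.sub ![x, y]

/-- The interpretation of `At`. -/
def Atm (x : M) : Prop := Structure.RelMap (L := msoLang) MSORel.atom ![x]

/-- The interpretation of `◁`. -/
def Prec (x y : M) : Prop := Structure.RelMap (L := msoLang) MSORel.prec ![x, y]

/-- The interpretation of `⊥`. -/
def bt (M : Type w) [msoLang.Structure M] : M :=
  Structure.funMap (L := msoLang) MSOFunc.bot ![]

variable {α : Type} {n : ℕ} {e : α → M} {xs : Fin n → M}

@[simp] theorem realize_subF (s t : α ⊕ Fin n) :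
    (subF s t).Realize e xs ↔ Sub (Sum.elim e xs s) (Sum.elim e xs t) := by
  exact BoundedFormula.realize_rel₂

@[simp] theorem realize_atomF (s : α ⊕ Fin n) :
    (atomF s).Realize e xs ↔ Atm (Sum.elim e xs s) := by
  exact BoundedFormula.realize_rel₁

@[simp] theorem realize_precF (s t : α ⊕ Fin n) :
    (precF s t).Realize e xs ↔ Prec (Sum.elim e xs s) (Sum.elim e xs t) := by
  exact BoundedFormula.realize_rel₂

@[simp] theorem realize_eqF (s t : α ⊕ Fin n) :
    (eqF s t).Realize e xs ↔ Sum.elim e xs s = Sum.elim e xs t := by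
  simp [eqF]

@[simp] theorem realize_botF (s : α ⊕ Fin n) :
    (botF s).Realize e xs ↔ Sum.elim e xs s = bt M := by
  have h : Term.realize (Sum.elim e xs) (Constants.term (L := msoLang) MSOFunc.bot) = bt M :=
    congrArg (Structure.funMap (L := msoLang) MSOFunc.bot) (Subsingleton.elim _ _)
  rw [← h]
  exact Iff.rfl

@[simp] theorem realize_allAtom (φ : msoLang.BoundedFormula α (n + 1)) :
    (allAtom φ).Realize e xs ↔ ∀ a : M, Atm a → φ.Realize e (Fin.snoc xs a) := by
  simp [allAtom]

@[simp] theorem realize_exAtom (φ : msoLang.BoundedFormula α (n + 1)) :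
    (exAtom φ).Realize e xs ↔ ∃ a : M, Atm a ∧ φ.Realize e (Fin.snoc xs a) := by
  simp [exAtom]

/-- `z` is the infimum of `x` and `y` with respect to `⊆`. -/
def IsInf (z x y : M) : Prop := (Sub z x ∧ Sub z y) ∧ ∀ t, Sub t x ∧ Sub t y → Sub t z

/-- `z` is the supremum of `x` and `y` with respect to `⊆`. -/
def IsSup (z x y : M) : Prop := (Sub x z ∧ Sub y z) ∧ ∀ t, Sub x t ∧ Sub y t → Sub z t

/-- `x` and `y` are complements with respect to `⊆`. -/
def IsComp (x y : M) : Prop :=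
  (∀ t, Sub t x ∧ Sub t y → t = bt M) ∧ ∀ t, Sub x t ∧ Sub y t → ∀ s, Sub s t

/-- `x` is downward closed. -/
def Dwcl (x : M) : Prop := ∀ a, Atm a → ∀ c, Atm c → Sub a x ∧ Prec c a → Sub c x

@[simp] theorem realize_infF (z x y : α ⊕ Fin n) : (infF z x y).Realize e xs ↔
    IsInf (Sum.elim e xs z) (Sum.elim e xs x) (Sum.elim e xs y) := by
  simp [infF, IsInf]

@[simp] theorem realize_supF (z x y : α ⊕ Fin n) : (supF z x y).Realize e xs ↔
    IsSup (Sum.elim e xs z) (Sum.elim e xs x) (Sum.elim e xs y) := by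
  simp [supF, IsSup]

@[simp] theorem realize_complF (x y : α ⊕ Fin n) : (complF x y).Realize e xs ↔
    IsComp (Sum.elim e xs x) (Sum.elim e xs y) := by
  simp [complF, IsComp]

@[simp] theorem realize_dwclF (x : α ⊕ Fin n) : (dwclF x).Realize e xs ↔
    Dwcl (Sum.elim e xs x) := by
  simp [dwclF, Dwcl]

/-- Comprehension for `M`, semantically. -/
theorem realize_compAx {k : ℕ} (η : msoLang.Formula (Fin k ⊕ Unit)) :
    M ⊨ compAx η ↔ ∀ ys : Fin k → M, ∃ X : M, ∀ x, Atm x →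
      (Sub x X ↔ η.Realize (Sum.elim ys fun _ => x)) := by
  unfold compAx Sentence.Realize
  rw [BoundedFormula.realize_alls]
  refine forall_congr' fun ys => ?_
  rw [BoundedFormula.realize_ex]
  refine exists_congr fun X => ?_
  rw [realize_allAtom]
  refine forall_congr' fun x => imp_congr_right fun _ => ?_
  rw [BoundedFormula.realize_iff, realize_subF, elim_up, elim_new, elim_new]
  refine iff_congr Iff.rfl ?_
  refine (BoundedFormula.realize_relabel (n := 0)).trans ?_
  refine iff_of_eq (congr (congrArg (BoundedFormula.Realize η) ?_) (Subsingleton.elim _ _))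
  funext i
  rcases i with i | i
  · exact (elim_up (up (Sum.inr i))).trans (elim_up (Sum.inr i))
  · exact elim_new

/-- The models of `T_MSO(Fin)`, semantically. -/
structure IsFinModel (M : Type w) [msoLang.Structure M] : Prop where
  refl : ∀ x : M, Sub x x
  trans : ∀ x y z : M, Sub x y ∧ Sub y z → Sub x z
  antisymm : ∀ x y : M, Sub x y ∧ Sub y x → x = y
  bot : ∀ y : M, Sub (bt M) y
  top : ∃ x : M, ∀ y, Sub y x
  inf : ∀ x y : M, ∃ z, IsInf z x y
  sup : ∀ x y : M, ∃ z, IsSup z x y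
  distrib : ∀ x y z j p q r : M,
    IsSup j y z → IsInf p x j → IsInf q x y → IsInf r x z → IsSup p q r
  compl : ∀ x : M, ∃ y, IsComp x y
  atom : ∀ x : M, Atm x ↔ x ≠ bt M ∧ ∀ y, Sub y x → y = bt M ∨ y = x
  atomic : ∀ x : M, x ≠ bt M → ∃ a, Atm a ∧ Sub a x
  irrefl : ∀ x : M, Atm x → ¬ Prec x x
  ptrans : ∀ x : M, Atm x → ∀ y, Atm y → ∀ z, Atm z → Prec x y ∧ Prec y z → Prec x z
  total : ∀ x : M, Atm x → ∀ y, Atm y → Prec x y ∨ x = y ∨ Prec y x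
  prec : ∀ x y : M, Prec x y ↔ ∃ a, Atm a ∧ ∃ c, Atm c ∧ Sub a x ∧ Sub c y ∧ Prec a c
  comp : ∀ {k : ℕ} (η : msoLang.Formula (Fin k ⊕ Unit)) (ys : Fin k → M), ∃ X : M,
    ∀ x, Atm x → (Sub x X ↔ η.Realize (Sum.elim ys fun _ => x))
  first : (∃ x : M, Atm x) → ∃ x : M, Atm x ∧ ∀ y, Atm y → ¬ Prec y x
  last : (∃ x : M, Atm x) → ∃ x : M, Atm x ∧ ∀ y, Atm y → ¬ Prec x y
  succ : ∀ x : M, Atm x → (∃ y, Atm y ∧ Prec x y) →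
    ∃ y, Atm y ∧ Prec x y ∧ ∀ z, Atm z → ¬ (Prec x z ∧ Prec z y)
  pred : ∀ x : M, Atm x → (∃ y, Atm y ∧ Prec y x) →
    ∃ y, Atm y ∧ Prec y x ∧ ∀ z, Atm z → ¬ (Prec y z ∧ Prec z x)
  least : ∀ x : M, x ≠ bt M → ∃ a, Atm a ∧ Sub a x ∧ ∀ c, Atm c → Prec c a → ¬ Sub c x

theorem model_TFin_iff : M ⊨ TFin ↔ IsFinModel M := by
  constructor
  · intro h
    have H : ∀ φ, FinAx φ → M ⊨ φ := fun φ hφ => h.realize_of_mem φ hφ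
    constructor
    · have := H _ (.base (.boolean .refl))
      simpa [Sentence.Realize, Formula.Realize, Fin.snoc] using this
    · have := H _ (.base (.boolean .trans))
      simpa [Sentence.Realize, Formula.Realize, Fin.snoc] using this
    · have := H _ (.base (.boolean .antisymm))
      simpa [Sentence.Realize, Formula.Realize, Fin.snoc] using this
    · have := H _ (.base (.boolean .bot))
      intro y
      simp only [Sentence.Realize, Formula.Realize, BoundedFormula.realize_all,
        BoundedFormula.realize_imp] at this
      simpa [Fin.snoc] using this (bt M) y
    · have := H _ (.base (.boolean .top))
      simpa [Sentence.Realize, Formula.Realize, Fin.snoc] using this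
    · have := H _ (.base (.boolean .inf))
      simpa [Sentence.Realize, Formula.Realize, Fin.snoc] using this
    · have := H _ (.base (.boolean .sup))
      simpa [Sentence.Realize, Formula.Realize, Fin.snoc] using this
    · have := H _ (.base (.boolean .distrib))
      simpa [Sentence.Realize, Formula.Realize, Fin.snoc] using this
    · have := H _ (.base (.boolean .compl))
      simpa [Sentence.Realize, Formula.Realize, Fin.snoc] using this
    · have := H _ (.base .atom)
      simpa [Sentence.Realize, Formula.Realize, Fin.snoc] using this
    · have := H _ (.base .atomic)
      simpa [Sentence.Realize, Formula.Realize, Fin.snoc] using this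
    · have := H _ (.base .irrefl)
      simpa [Sentence.Realize, Formula.Realize, Fin.snoc] using this
    · have := H _ (.base .trans)
      simpa [Sentence.Realize, Formula.Realize, Fin.snoc] using this
    · have := H _ (.base .total)
      simpa [Sentence.Realize, Formula.Realize, Fin.snoc] using this
    · have := H _ (.base .prec)
      simpa [Sentence.Realize, Formula.Realize, Fin.snoc] using this
    · intro k η
      exact (realize_compAx η).1 (H _ (.base (.comp η)))
    · have := H _ .first
      simpa [Sentence.Realize, Formula.Realize, Fin.snoc] using this
    · have := H _ .last
      simpa [Sentence.Realize, Formula.Realize, Fin.snoc] using this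
    · have := H _ .succ
      simpa [Sentence.Realize, Formula.Realize, Fin.snoc] using this
    · have := H _ .pred
      simpa [Sentence.Realize, Formula.Realize, Fin.snoc] using this
    · have := H _ .least
      simpa [Sentence.Realize, Formula.Realize, Fin.snoc] using this
  · intro h
    refine ⟨fun φ hφ => ?_⟩
    cases hφ with
    | base hφ =>
      cases hφ with
      | boolean hφ =>
        cases hφ with
        | refl => simpa [Sentence.Realize, Formula.Realize, Fin.snoc] using h.refl
        | trans => simpa [Sentence.Realize, Formula.Realize, Fin.snoc] using h.trans
        | antisymm => simpa [Sentence.Realize, Formula.Realize, Fin.snoc] using h.antisymm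
        | bot => simpa [Sentence.Realize, Formula.Realize, Fin.snoc] using
            fun a c (hc : a = bt M) => hc ▸ h.bot c
        | top => simpa [Sentence.Realize, Formula.Realize, Fin.snoc] using h.top
        | inf => simpa [Sentence.Realize, Formula.Realize, Fin.snoc] using h.inf
        | sup => simpa [Sentence.Realize, Formula.Realize, Fin.snoc] using h.sup
        | distrib => simpa [Sentence.Realize, Formula.Realize, Fin.snoc] using h.distrib
        | compl => simpa [Sentence.Realize, Formula.Realize, Fin.snoc] using h.compl
      | atom => simpa [Sentence.Realize, Formula.Realize, Fin.snoc] using h.atom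
      | atomic => simpa [Sentence.Realize, Formula.Realize, Fin.snoc] using h.atomic
      | irrefl => simpa [Sentence.Realize, Formula.Realize, Fin.snoc] using h.irrefl
      | trans => simpa [Sentence.Realize, Formula.Realize, Fin.snoc] using h.ptrans
      | total => simpa [Sentence.Realize, Formula.Realize, Fin.snoc] using h.total
      | prec => simpa [Sentence.Realize, Formula.Realize, Fin.snoc] using h.prec
      | comp η => exact (realize_compAx η).2 (h.comp η)
    | first => simpa [Sentence.Realize, Formula.Realize, Fin.snoc] using h.first
    | last => simpa [Sentence.Realize, Formula.Realize, Fin.snoc] using h.last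
    | succ => simpa [Sentence.Realize, Formula.Realize, Fin.snoc] using h.succ
    | pred => simpa [Sentence.Realize, Formula.Realize, Fin.snoc] using h.pred
    | least => simpa [Sentence.Realize, Formula.Realize, Fin.snoc] using h.least

end Semantics

/-! ### Relativisation -/

section Relativisation

/-- The relativisation `φ^X` of a formula to the elements below a new free variable `X`,
which is `Sum.inr ()`. -/
def relativize {α : Type} : {n : ℕ} → msoLang.BoundedFormula α n →
    msoLang.BoundedFormula (α ⊕ Unit) n
  | _, .falsum => .falsum
  | _, .equal s t => .equal (s.relabel (Sum.map Sum.inl id)) (t.relabel (Sum.map Sum.inl id))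
  | _, .rel R ts => .rel R fun i => (ts i).relabel (Sum.map Sum.inl id)
  | _, .imp φ ψ => .imp (relativize φ) (relativize ψ)
  | _, .all φ => ((subF new (Sum.inl (Sum.inr ()))).imp (relativize φ)).all

/-- The relativisation of a sentence to the elements below the `i`-th bound variable. -/
def relTo {n : ℕ} (i : Fin n) (φ : msoLang.Sentence) : msoLang.BoundedFormula Empty n :=
  BoundedFormula.relabel (n := n) (k := 0) (Sum.elim Empty.elim fun _ => Sum.inr i)
    (relativize φ)

/-- The sentence `φ + ψ`: for some downward closed `X`, `φ` holds relativised to `X` and `ψ` holds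
relativised to the complement of `X` (which is the variable `1`). -/
def sumF (φ ψ : msoLang.Sentence) : msoLang.Sentence :=
  ((dwclF (b 0) ⊓ complF (b 0) (b 1)) ⊓ (relTo 0 φ ⊓ relTo 1 ψ)).ex.ex

variable {M : Type w} [msoLang.Structure M]

/-- The substructure of `M` consisting of the elements below `A`. -/
def restr (hb : ∀ y : M, Sub (bt M) y) (A : M) : msoLang.Substructure M where
  carrier := {x | Sub x A}
  fun_mem := by
    intro n f
    cases f
    intro xs _
    have : xs = ![] := Subsingleton.elim _ _
    subst this
    exact hb A

theorem realize_relativize (hb : ∀ y : M, Sub (bt M) y) (A : M) {α : Type} {n : ℕ}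
    (φ : msoLang.BoundedFormula α n) (e : α → restr hb A) (xs : Fin n → restr hb A) :
    (relativize φ).Realize (Sum.elim (fun i => (e i : M)) fun _ => A) (fun i => (xs i : M)) ↔
      φ.Realize e xs := by
  have hterm : ∀ {m : ℕ} (ys : Fin m → restr hb A) (t : msoLang.Term (α ⊕ Fin m)),
      (t.relabel (Sum.map Sum.inl id : α ⊕ Fin m → (α ⊕ Unit) ⊕ Fin m)).realize
        (Sum.elim (Sum.elim (fun i => (e i : M)) fun _ => A) fun i => (ys i : M)) =
      (t.realize (Sum.elim e ys) : restr hb A) := by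
    intro m ys t
    induction t with
    | var i => rcases i with i | i <;> rfl
    | func f ts ih =>
      simp only [Term.relabel, Term.realize_func, ih]
      rfl
  induction φ with
  | falsum => exact Iff.rfl
  | equal s t =>
    simp only [relativize, BoundedFormula.Realize, hterm]
    exact Subtype.coe_inj
  | rel R ts =>
    simp only [relativize, BoundedFormula.Realize, hterm]
    rfl
  | imp φ ψ ih1 ih2 =>
    simp only [relativize, BoundedFormula.realize_imp, ih1, ih2]
  | all φ ih =>
    simp only [relativize, BoundedFormula.realize_all, BoundedFormula.realize_imp, realize_subF,
      elim_new]
    have key : ∀ a : restr hb A, (relativize φ).Realize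
        (Sum.elim (fun i => (e i : M)) fun _ => A)
        (Fin.snoc (fun i => (xs i : M)) (a : M)) ↔ φ.Realize e (Fin.snoc xs a) := by
      intro a
      refine Iff.trans (iff_of_eq (congrArg _ ?_)) (ih (Fin.snoc xs a))
      funext i
      refine Fin.lastCases ?_ (fun j => ?_) i <;> simp
    constructor
    · intro h a
      exact (key a).1 (h a a.2)
    · intro h a ha
      exact (key ⟨a, ha⟩).2 (h ⟨a, ha⟩)

theorem realize_relTo (hb : ∀ y : M, Sub (bt M) y) {n : ℕ} (i : Fin n) (φ : msoLang.Sentence)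
    (e : Empty → M) (xs : Fin n → M) :
    (relTo i φ).Realize e xs ↔ restr hb (xs i) ⊨ φ := by
  refine (BoundedFormula.realize_relabel (n := 0)).trans ?_
  refine Iff.trans (iff_of_eq ?_) (realize_relativize hb (xs i) φ default default)
  refine congr (congrArg (BoundedFormula.Realize (relativize φ)) ?_) (Subsingleton.elim _ _)
  funext j
  rcases j with j | j
  · exact j.elim
  · rfl

theorem realize_sumF (hb : ∀ y : M, Sub (bt M) y) (φ ψ : msoLang.Sentence) :
    M ⊨ sumF φ ψ ↔ ∃ X Z : M, (Dwcl X ∧ IsComp X Z) ∧ restr hb X ⊨ φ ∧ restr hb Z ⊨ ψ := by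
  simp only [sumF, Sentence.Realize, Formula.Realize, BoundedFormula.realize_ex,
    BoundedFormula.realize_inf, realize_dwclF, realize_complF, realize_relTo hb]
  rfl

/-! ### Restrictions of models are models -/

section Restriction

variable (hb : ∀ y : M, Sub (bt M) y) (A : M)

theorem coe_bt : ((bt (restr hb A) : restr hb A) : M) = bt M :=
  congrArg (Structure.funMap (L := msoLang) MSOFunc.bot) (Subsingleton.elim _ _)

theorem sub_coe (x y : restr hb A) : Sub x y ↔ Sub (x : M) (y : M) := by
  have key : (fun i => ((![x, y] : Fin 2 → restr hb A) i : M)) = ![(x : M), (y : M)] := by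
    funext i
    fin_cases i <;> rfl
  exact iff_of_eq (congrArg (Structure.RelMap (L := msoLang) MSORel.sub) key)

theorem prec_coe (x y : restr hb A) : Prec x y ↔ Prec (x : M) (y : M) := by
  have key : (fun i => ((![x, y] : Fin 2 → restr hb A) i : M)) = ![(x : M), (y : M)] := by
    funext i
    fin_cases i <;> rfl
  exact iff_of_eq (congrArg (Structure.RelMap (L := msoLang) MSORel.prec) key)

theorem atm_coe (x : restr hb A) : Atm x ↔ Atm (x : M) := by
  have key : (fun i => ((![x] : Fin 1 → restr hb A) i : M)) = ![(x : M)] := by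
    funext i
    fin_cases i
    rfl
  exact iff_of_eq (congrArg (Structure.RelMap (L := msoLang) MSORel.atom) key)

theorem bt_coe_iff (x : restr hb A) : x = bt (restr hb A) ↔ (x : M) = bt M := by
  rw [← coe_bt hb A]
  exact Subtype.coe_inj.symm

theorem isInf_coe (h : IsFinModel M) (z x y : restr h.bot A) :
    IsInf z x y ↔ IsInf (z : M) (x : M) (y : M) := by
  constructor
  · rintro ⟨⟨h1, h2⟩, h3⟩
    rw [sub_coe] at h1 h2
    refine ⟨⟨h1, h2⟩, fun t ht => ?_⟩
    have := h3 ⟨t, h.trans _ _ _ ⟨ht.1, x.2⟩⟩ (by simpa only [sub_coe] using ht)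
    simpa only [sub_coe] using this
  · rintro ⟨⟨h1, h2⟩, h3⟩
    refine ⟨⟨(sub_coe ..).2 h1, (sub_coe ..).2 h2⟩, fun t ht => ?_⟩
    simp only [sub_coe] at ht ⊢
    exact h3 t ht

theorem isSup_coe (h : IsFinModel M) (z x y : restr h.bot A) :
    IsSup z x y ↔ IsSup (z : M) (x : M) (y : M) := by
  constructor
  · rintro ⟨⟨h1, h2⟩, h3⟩
    rw [sub_coe] at h1 h2
    obtain ⟨j, hj⟩ := h.sup (x : M) y
    have hjz : Sub j z := hj.2 _ ⟨h1, h2⟩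
    refine ⟨⟨h1, h2⟩, fun t ht => ?_⟩
    have := h3 ⟨j, h.trans _ _ _ ⟨hjz, z.2⟩⟩ (by simpa only [sub_coe] using hj.1)
    rw [sub_coe] at this
    exact h.trans _ _ _ ⟨this, hj.2 t ht⟩
  · rintro ⟨⟨h1, h2⟩, h3⟩
    refine ⟨⟨(sub_coe ..).2 h1, (sub_coe ..).2 h2⟩, fun t ht => ?_⟩
    simp only [sub_coe] at ht ⊢
    exact h3 t ht

/-- The restriction of a model of `T_MSO(Fin)` to a convex element in which, unless it is `⊥`,
there is a last atom, is again a model. -/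
theorem IsFinModel.restrict (h : IsFinModel M)
    (hconv : ∀ x y z : M, Atm x → Atm y → Atm z → Sub x A → Sub y A → Prec x z → Prec z y →
      Sub z A)
    (hlast : (∃ x : M, Atm x ∧ Sub x A) →
      ∃ x : M, Atm x ∧ Sub x A ∧ ∀ y, Atm y → Sub y A → ¬ Prec x y) :
    IsFinModel (restr h.bot A) where
  refl x := (sub_coe ..).2 (h.refl _)
  trans x y z := by
    simp only [sub_coe]
    exact h.trans _ _ _
  antisymm x y := by
    simp only [sub_coe]
    exact fun hxy => Subtype.ext (h.antisymm _ _ hxy)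
  bot y := by
    rw [sub_coe, coe_bt]
    exact h.bot _
  top := ⟨⟨A, h.refl A⟩, fun y => (sub_coe ..).2 y.2⟩
  inf x y := by
    obtain ⟨z, hz⟩ := h.inf (x : M) y
    exact ⟨⟨z, h.trans _ _ _ ⟨hz.1.1, x.2⟩⟩, (isInf_coe A h _ _ _).2 hz⟩
  sup x y := by
    obtain ⟨z, hz⟩ := h.sup (x : M) y
    exact ⟨⟨z, hz.2 _ ⟨x.2, y.2⟩⟩, (isSup_coe A h _ _ _).2 hz⟩
  distrib x y z j p q r := by
    simp only [isInf_coe A h, isSup_coe A h]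
    exact h.distrib _ _ _ _ _ _ _
  compl x := by
    obtain ⟨y, hy⟩ := h.compl (x : M)
    obtain ⟨z, hz⟩ := h.inf A y
    obtain ⟨j, hj⟩ := h.sup (x : M) y
    refine ⟨⟨z, hz.1.1⟩, fun t ht => ?_, fun t ht s => ?_⟩
    · simp only [sub_coe] at ht
      rw [bt_coe_iff]
      exact hy.1 _ ⟨ht.1, h.trans _ _ _ ⟨ht.2, hz.1.2⟩⟩
    · simp only [sub_coe] at ht ⊢
      have hjA : Sub A j := hy.2 _ hj.1 _
      have hp : IsInf A A j := ⟨⟨h.refl _, hjA⟩, fun _ ht => ht.1⟩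
      have hq : IsInf (x : M) A x := ⟨⟨x.2, h.refl _⟩, fun _ ht => ht.2⟩
      exact h.trans _ _ _ ⟨s.2, (h.distrib A x y j A x z hj hp hq hz).2 _ ht⟩
  atom x := by
    rw [atm_coe, h.atom, ne_eq, ne_eq, bt_coe_iff]
    refine and_congr Iff.rfl ⟨fun hx y hy => ?_, fun hx y hy => ?_⟩
    · rw [bt_coe_iff, Subtype.ext_iff]
      exact hx _ ((sub_coe ..).1 hy)
    · have := hx ⟨y, h.trans _ _ _ ⟨hy, x.2⟩⟩ ((sub_coe ..).2 hy)
      rwa [bt_coe_iff, Subtype.ext_iff] at this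
  atomic x hx := by
    rw [ne_eq, bt_coe_iff] at hx
    obtain ⟨a, ha, hax⟩ := h.atomic _ hx
    exact ⟨⟨a, h.trans _ _ _ ⟨hax, x.2⟩⟩, (atm_coe ..).2 ha, (sub_coe ..).2 hax⟩
  irrefl x := by
    rw [atm_coe, prec_coe]
    exact h.irrefl _
  ptrans x hx y hy z hz := by
    simp only [atm_coe, prec_coe] at *
    exact h.ptrans _ hx _ hy _ hz
  total x hx y hy := by
    simp only [atm_coe, prec_coe, Subtype.ext_iff] at *
    exact h.total _ hx _ hy
  prec x y := by
    rw [prec_coe, h.prec]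
    constructor
    · rintro ⟨a, ha, c, hc, hax, hcy, hac⟩
      refine ⟨⟨a, h.trans _ _ _ ⟨hax, x.2⟩⟩, (atm_coe ..).2 ha,
        ⟨c, h.trans _ _ _ ⟨hcy, y.2⟩⟩, (atm_coe ..).2 hc, ?_⟩
      simp only [sub_coe, prec_coe]
      exact ⟨hax, hcy, hac⟩
    · rintro ⟨a, ha, c, hc, h3⟩
      simp only [atm_coe, sub_coe, prec_coe] at ha hc h3
      exact ⟨a, ha, c, hc, h3⟩
  comp {k} η ys := by
    let g : (Fin k ⊕ Unit) ⊕ Unit → Fin (k + 1) ⊕ Unit :=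
      Sum.elim (Sum.elim (fun i => Sum.inl i.castSucc) Sum.inr) fun _ => Sum.inl (Fin.last k)
    obtain ⟨X, hX⟩ := h.comp (Formula.relabel g (relativize η))
      (Fin.snoc (fun i => (ys i : M)) A : Fin (k + 1) → M)
    obtain ⟨Y, hY⟩ := h.inf X A
    refine ⟨⟨Y, hY.1.2⟩, fun x hx => ?_⟩
    rw [atm_coe] at hx
    have h1 : Sub x (⟨Y, hY.1.2⟩ : restr h.bot A) ↔ Sub (x : M) X := by
      rw [sub_coe]
      exact ⟨fun hxY => h.trans _ _ _ ⟨hxY, hY.1.1⟩, fun hxX => hY.2 _ ⟨hxX, x.2⟩⟩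
    rw [h1, hX _ hx, Formula.realize_relabel]
    refine Iff.trans (iff_of_eq ?_)
      (realize_relativize h.bot A η (Sum.elim ys fun _ => x) default)
    refine congr (congrArg (BoundedFormula.Realize (relativize η)) ?_) (Subsingleton.elim _ _)
    funext i
    rcases i with (i | i) | i <;> simp [g]
  first := by
    rintro ⟨x, hx⟩
    rw [atm_coe] at hx
    have hA : A ≠ bt M := by
      rintro rfl
      exact ((h.atom _).1 hx).1 (h.antisymm _ _ ⟨x.2, h.bot _⟩)
    obtain ⟨a, ha, haA, hmin⟩ := h.least A hA
    refine ⟨⟨a, haA⟩, (atm_coe ..).2 ha, fun y hy hya => ?_⟩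
    exact hmin _ ((atm_coe ..).1 hy) ((prec_coe ..).1 hya) y.2
  last := by
    rintro ⟨x, hx⟩
    obtain ⟨a, ha, haA, hmax⟩ := hlast ⟨x, (atm_coe ..).1 hx, x.2⟩
    refine ⟨⟨a, haA⟩, (atm_coe ..).2 ha, fun y hy hya => ?_⟩
    exact hmax _ ((atm_coe ..).1 hy) y.2 ((prec_coe ..).1 hya)
  succ x hx := by
    rintro ⟨y, hy, hxy⟩
    simp only [atm_coe, prec_coe] at hx hy hxy
    obtain ⟨s, hs, hxs, hsmin⟩ := h.succ _ hx ⟨_, hy, hxy⟩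
    have hsA : Sub s A := by
      rcases h.total _ hs _ hy with h1 | h1 | h1
      · exact hconv _ _ _ hx hy hs x.2 y.2 hxs h1
      · exact h1 ▸ y.2
      · exact absurd ⟨hxy, h1⟩ (hsmin _ hy)
    refine ⟨⟨s, hsA⟩, (atm_coe ..).2 hs, (prec_coe ..).2 hxs, fun z hz => ?_⟩
    simp only [prec_coe]
    exact hsmin _ ((atm_coe ..).1 hz)
  pred x hx := by
    rintro ⟨y, hy, hxy⟩
    simp only [atm_coe, prec_coe] at hx hy hxy
    obtain ⟨s, hs, hxs, hsmin⟩ := h.pred _ hx ⟨_, hy, hxy⟩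
    have hsA : Sub s A := by
      rcases h.total _ hs _ hy with h1 | h1 | h1
      · exact absurd ⟨h1, hxy⟩ (hsmin _ hy)
      · exact h1 ▸ y.2
      · exact hconv _ _ _ hy hx hs y.2 x.2 h1 hxs
    refine ⟨⟨s, hsA⟩, (atm_coe ..).2 hs, (prec_coe ..).2 hxs, fun z hz => ?_⟩
    simp only [prec_coe]
    exact hsmin _ ((atm_coe ..).1 hz)
  least x hx := by
    rw [ne_eq, bt_coe_iff] at hx
    obtain ⟨a, ha, hax, hmin⟩ := h.least _ hx
    refine ⟨⟨a, h.trans _ _ _ ⟨hax, x.2⟩⟩, (atm_coe ..).2 ha, (sub_coe ..).2 hax,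
      fun c hc hca => ?_⟩
    rw [sub_coe]
    exact hmin _ ((atm_coe ..).1 hc) ((prec_coe ..).1 hca)

theorem IsFinModel.not_both (h : IsFinModel M) {X Z a : M} (hc : IsComp X Z) (ha : Atm a)
    (h1 : Sub a X) (h2 : Sub a Z) : False :=
  ((h.atom a).1 ha).1 (hc.1 a ⟨h1, h2⟩)

theorem IsFinModel.one_of (h : IsFinModel M) {X Z a : M} (hc : IsComp X Z) (ha : Atm a) :
    Sub a X ∨ Sub a Z := by
  obtain ⟨j, hj⟩ := h.sup X Z
  obtain ⟨q, hq⟩ := h.inf a X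
  obtain ⟨r, hr⟩ := h.inf a Z
  have hp : IsInf a a j := ⟨⟨h.refl _, hc.2 _ hj.1 _⟩, fun _ ht => ht.1⟩
  have hs := h.distrib a X Z j a q r hj hp hq hr
  rcases ((h.atom a).1 ha).2 q hq.1.1 with h1 | h1
  · right
    have : Sub a r := hs.2 r ⟨h1 ▸ h.bot r, h.refl r⟩
    exact h.trans _ _ _ ⟨this, hr.1.2⟩
  · left
    have := hq.1.2
    rwa [h1] at this

/-- Downward closed elements and their complements cut out models of `T_MSO(Fin)`. -/
theorem IsFinModel.restr_dwcl (h : IsFinModel M) {X Z : M} (hX : Dwcl X) (hc : IsComp X Z) :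
    IsFinModel (restr h.bot X) ∧ IsFinModel (restr h.bot Z) := by
  have hZ : ∀ a c : M, Atm a → Atm c → Sub a Z → Prec a c → Sub c Z := by
    intro a c ha hcc haZ hac
    rcases h.one_of hc hcc with h1 | h1
    · exact (h.not_both hc ha (hX c hcc a ha ⟨h1, hac⟩) haZ).elim
    · exact h1
  constructor
  · refine h.restrict X (fun x y z _ hy hz _ hyX _ hzy => hX y hy z hz ⟨hyX, hzy⟩) ?_
    rintro ⟨x, hx, hxX⟩
    by_cases hZb : Z = bt M
    · obtain ⟨l, hl, hmax⟩ := h.last ⟨x, hx⟩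
      refine ⟨l, hl, ?_, fun y hy _ => hmax y hy⟩
      rcases h.one_of hc hl with h1 | h1
      · exact h1
      · exact (((h.atom l).1 hl).1 (h.antisymm _ _ ⟨hZb ▸ h1, h.bot _⟩)).elim
    · obtain ⟨c, hcc, hcZ, hmin⟩ := h.least Z hZb
      have hlt : ∀ a, Atm a → Sub a X → Prec a c := by
        intro a ha haX
        rcases h.total a ha c hcc with h1 | h1 | h1
        · exact h1
        · exact (h.not_both hc ha haX (h1 ▸ hcZ)).elim
        · exact (h.not_both hc hcc (hX a ha c hcc ⟨haX, h1⟩) hcZ).elim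
      obtain ⟨p, hp, hpc, hpm⟩ := h.pred c hcc ⟨x, hx, hlt x hx hxX⟩
      refine ⟨p, hp, (h.one_of hc hp).resolve_right (hmin p hp hpc), fun y hy hyX hpy => ?_⟩
      exact hpm y hy ⟨hpy, hlt y hy hyX⟩
  · refine h.restrict Z (fun x y z hx _ hz hxZ _ hxz _ => hZ x z hx hz hxZ hxz) ?_
    rintro ⟨x, hx, hxZ⟩
    obtain ⟨l, hl, hmax⟩ := h.last ⟨x, hx⟩
    refine ⟨l, hl, ?_, fun y hy _ => hmax y hy⟩
    rcases h.total x hx l hl with h1 | h1 | h1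
    · exact hZ x l hx hl hxZ h1
    · exact h1 ▸ hxZ
    · exact (hmax x hx h1).elim

end Restriction

end Relativisation

/-! ### The Lindenbaum–Tarski algebra and the space of completions of a theory -/

section LindenbaumTarski

variable {L : FirstOrder.Language.{u, v}}

/-- Sentences modulo equivalence over `T`. -/
def LTAlg (T : L.Theory) : Type (max u v) :=
  Quotient (Theory.iffSetoid T : Setoid (L.BoundedFormula Empty 0))

namespace LTAlg

variable {T : L.Theory}

/-- The class of a sentence. -/
def mk (T : L.Theory) (φ : L.Sentence) : LTAlg T := Quotient.mk _ φ

/-- The models (in a fixed universe) of the sentences in a class. -/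
def models (x : LTAlg T) : Set (Theory.ModelType.{u, v, max u v} T) :=
  Quotient.lift (fun φ : L.Sentence => {M : Theory.ModelType.{u, v, max u v} T | M ⊨ φ})
    (fun _ _ h => Set.ext fun M => Theory.Iff.models_sentence_iff (M := M) h) x

theorem mk_eq_mk {φ ψ : L.Sentence} : mk T φ = mk T ψ ↔ T ⊨ᵇ φ.iff ψ := Quotient.eq

theorem models_injective : Function.Injective (models (T := T)) := by
  rintro ⟨φ⟩ ⟨ψ⟩ h
  refine mk_eq_mk.2 (Theory.models_sentence_iff.2 fun M => ?_)
  rw [Sentence.realize_iff]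
  exact Set.ext_iff.1 h M

instance : Max (LTAlg T) := ⟨Quotient.map₂ (fun φ ψ : L.Sentence => φ ⊔ ψ) (by
  intro φ φ' h ψ ψ' h' M e xs
  have h1 := h M e xs
  have h2 := h' M e xs
  simp only [BoundedFormula.realize_iff, BoundedFormula.realize_sup] at *
  exact or_congr h1 h2)⟩

instance : Min (LTAlg T) := ⟨Quotient.map₂ (fun φ ψ : L.Sentence => φ ⊓ ψ) (by
  intro φ φ' h ψ ψ' h' M e xs
  have h1 := h M e xs
  have h2 := h' M e xs
  simp only [BoundedFormula.realize_iff, BoundedFormula.realize_inf] at *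
  exact and_congr h1 h2)⟩

instance : HImp (LTAlg T) := ⟨Quotient.map₂ (fun φ ψ : L.Sentence => φ.imp ψ)
  (fun _ _ h _ _ h' => Theory.Iff.imp h h')⟩

instance : Compl (LTAlg T) := ⟨Quotient.map (fun φ : L.Sentence => φ.not)
  (fun _ _ h => Theory.Iff.not h)⟩

instance : SDiff (LTAlg T) := ⟨fun x y => x ⊓ yᶜ⟩

instance : Top (LTAlg T) := ⟨mk T ⊤⟩

instance : Bot (LTAlg T) := ⟨mk T ⊥⟩

/-- `[φ] ≤ [ψ]` holds when every model of `T` and `φ` satisfies `ψ`. -/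
instance : LE (LTAlg T) := ⟨fun x y => models x ⊆ models y⟩

instance : _root_.LT (LTAlg T) := ⟨fun x y => models x ⊂ models y⟩

/-- The Boolean algebra structure, given by the logical connectives. -/
instance : BooleanAlgebra (LTAlg T) :=
  Function.Injective.booleanAlgebra models models_injective Iff.rfl Iff.rfl
    (by
      rintro ⟨φ⟩ ⟨ψ⟩
      ext M
      exact Sentence.realize_sup M)
    (by
      rintro ⟨φ⟩ ⟨ψ⟩
      ext M
      exact Sentence.realize_inf M)
    (by
      ext M
      exact iff_of_true (Sentence.realize_top M) trivial)
    (by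
      ext M
      exact Iff.rfl)
    (by
      rintro ⟨φ⟩
      ext M
      exact Iff.rfl)
    (by
      rintro ⟨φ⟩ ⟨ψ⟩
      ext M
      exact Sentence.realize_inf M)
    (by
      rintro ⟨φ⟩ ⟨ψ⟩
      ext M
      rw [himp_eq]
      exact (Sentence.realize_imp M).trans (by
        rw [imp_iff_or_not]
        exact Iff.rfl))

theorem mk_le_mk {φ ψ : L.Sentence} : mk T φ ≤ mk T ψ ↔ T ⊨ᵇ φ.imp ψ := by
  rw [Theory.models_sentence_iff]
  exact forall_congr' fun M => (Sentence.realize_imp M).symm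

end LTAlg

/-- The completions of `T`: complete theories, given as maximal consistent sets of sentences,
that extend `T`. -/
def Completion (T : L.Theory) : Type (max u v) :=
  {T' : L.Theory // T ⊆ T' ∧ T'.IsMaximal}

/-- The space of `0`-types: the sets `⟨φ⟩` of completions containing `φ` form a basis. -/
instance (T : L.Theory) : TopologicalSpace (Completion T) :=
  TopologicalSpace.generateFrom {U | ∃ φ : L.Sentence, U = {x | φ ∈ x.1}}

end LindenbaumTarski

/-! ### Extended Stone duality -/

section ExtendedStone

/-- A normal additive binary operation on a Boolean algebra. -/
def IsNormalAdditive {A : Type u} [BooleanAlgebra A] (op : A → A → A) : Prop :=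
  (∀ a, op a ⊥ = ⊥ ∧ op ⊥ a = ⊥) ∧
    ∀ a b c, op (a ⊔ b) c = op a c ⊔ op b c ∧ op a (b ⊔ c) = op a b ⊔ op a c

/-- A compatible ternary relation on a topological space. -/
def IsCompatible {X : Type u} [TopologicalSpace X] (R : X → X → X → Prop) : Prop :=
  (∀ A B : Set X, IsClopen A → IsClopen B → IsClopen {z | ∃ x ∈ A, ∃ y ∈ B, R x y z}) ∧
    ∀ z, IsClosed {p : X × X | R p.1 p.2 z}

/-- The prime filters of a Boolean algebra. -/
def StoneDual (A : Type u) [BooleanAlgebra A] : Type u :=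
  {F : Order.PFilter A // F.IsPrime}

/-- The topology of the Stone dual: the sets of prime filters containing `a` form a basis. -/
instance (A : Type u) [BooleanAlgebra A] : TopologicalSpace (StoneDual A) :=
  TopologicalSpace.generateFrom {U | ∃ a : A, U = {x | a ∈ x.1}}

/-- The set of all products of an element of `x` with an element of `y`. -/
def lift {A : Type u} (op : A → A → A) (x y : Set A) : Set A := Set.image2 op x y

/-- The ternary relation on the Stone dual that is dual to a binary operation:
`R(x, y, z)` holds when all `a · b` with `a ∈ x` and `b ∈ y` belong to `z`. -/
def DualRel {A : Type u} [BooleanAlgebra A] (op : A → A → A) (x y z : StoneDual A) : Prop :=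
  lift op (x.1 : Set A) (y.1 : Set A) ⊆ (z.1 : Set A)

/-- The extended Stone dual of `(A, op)` is functional. -/
def IsFunctional {A : Type u} [BooleanAlgebra A] (op : A → A → A) : Prop :=
  ∀ x y : StoneDual A, ∃! z : StoneDual A, DualRel op x y z

/-- The filter generated by a subset of a Boolean algebra. -/
def filterGen {A : Type u} [BooleanAlgebra A] (S : Set A) : Set A :=
  {a | ∃ F : Finset A, (F : Set A) ⊆ S ∧ F.inf id ≤ a}

variable {L : FirstOrder.Language.{u, v}} {T : L.Theory}

theorem Completion.mem_iff (x : Completion T) {M : Type w} [L.Structure M] [Nonempty M]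
    (hM : M ⊨ x.1) (φ : L.Sentence) : φ ∈ x.1 ↔ M ⊨ φ :=
  (x.2.2.mem_iff_models φ).trans (x.2.2.isComplete.realize_sentence_iff φ M).symm

/-- The set of classes of the sentences in a completion `x` of `T`. -/
def Completion.classes (x : Completion T) : Set (LTAlg T) :=
  {a | ∃ φ ∈ x.1, LTAlg.mk T φ = a}

/-- The completion `x` consists of the sentences true in some fixed model of `T`. -/
theorem Completion.exists_model (x : Completion T) :
    ∃ M : Theory.ModelType.{u, v, max u v} T, ∀ a, a ∈ x.classes ↔ M ∈ a.models := by
  obtain ⟨N⟩ := x.2.2.1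
  have hN : N ⊨ T := (N.is_model).mono x.2.1
  refine ⟨Theory.ModelType.of T N, ?_⟩
  rintro ⟨φ⟩
  constructor
  · rintro ⟨ψ, hψ, h⟩
    rw [← h]
    exact (x.mem_iff N.is_model ψ).1 hψ
  · intro h
    exact ⟨φ, (x.mem_iff N.is_model φ).2 h, rfl⟩

/-- A completion of `T`, seen as a prime filter of the Lindenbaum–Tarski algebra of `T`. -/
def Completion.toStone (x : Completion T) : StoneDual (LTAlg T) :=
  ⟨Order.IsPFilter.toPFilter (F := x.classes) (by
    obtain ⟨M, hM⟩ := x.exists_model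
    refine Order.IsPFilter.of_def ⟨⊤, (hM _).2 (Sentence.realize_top M)⟩ ?_ ?_
    · intro a ha c hc
      rw [hM] at ha hc
      refine ⟨a ⊓ c, (hM _).2 ?_, inf_le_left, inf_le_right⟩
      rcases a with ⟨φ⟩
      rcases c with ⟨ψ⟩
      exact (Sentence.realize_inf M).2 ⟨ha, hc⟩
    · intro a c hac ha
      rw [hM] at ha ⊢
      exact hac ha), ⟨by
    obtain ⟨M, hM⟩ := x.exists_model
    have hset : (x.classes)ᶜ = {a : LTAlg T | M ∉ a.models} := by
      ext a
      exact not_congr (hM a)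
    change Order.IsIdeal (x.classes)ᶜ
    rw [hset]
    refine ⟨fun a c hca ha hc => ha (hca hc), ⟨⊥, fun h => h⟩, ?_⟩
    intro a ha c hc
    refine ⟨a ⊔ c, ?_, le_sup_left, le_sup_right⟩
    rcases a with ⟨φ⟩
    rcases c with ⟨ψ⟩
    exact fun h => ((Sentence.realize_sup M).1 h).elim ha hc⟩⟩

end ExtendedStone

/-! ### The two operations -/

/-- The operation `+` on the Lindenbaum–Tarski algebra of `T_MSO(Fin)`, given by
`[φ] + [ψ] = [φ + ψ]`. -/
def plus : LTAlg TFin → LTAlg TFin → LTAlg TFin :=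
  Quotient.map₂ sumF (by
    intro φ φ' h ψ ψ' h'
    refine Theory.models_sentence_iff.2 fun M => ?_
    have hM : IsFinModel M := model_TFin_iff.1 M.is_model
    rw [Sentence.realize_iff, realize_sumF hM.bot, realize_sumF hM.bot]
    refine exists_congr fun X => exists_congr fun Z => and_congr_right fun hXZ => ?_
    obtain ⟨h1, h2⟩ := hM.restr_dwcl hXZ.1 hXZ.2
    have : restr hM.bot X ⊨ TFin := model_TFin_iff.2 h1
    have : restr hM.bot Z ⊨ TFin := model_TFin_iff.2 h2
    have : Nonempty (restr hM.bot X) := ⟨bt _⟩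
    have : Nonempty (restr hM.bot Z) := ⟨bt _⟩
    exact and_congr (Theory.Iff.models_sentence_iff h) (Theory.Iff.models_sentence_iff h'))

/-- The underlying set of `M ⊗ N`. -/
def MSum (M : Type v) (N : Type w) : Type (max v w) := M × N

section MSum

variable (M : Type v) (N : Type w) [msoLang.Structure M] [msoLang.Structure N]

/-- Inclusion in `M ⊗ N`, as in the direct product. -/
def MSum.sub (p q : MSum M N) : Prop := Sub p.1 q.1 ∧ Sub p.2 q.2

/-- The bottom element of `M ⊗ N`. -/
def MSum.bot : MSum M N := (bt M, bt N)

/-- The atoms of `M ⊗ N`: the minimal elements other than the bottom element. -/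
def MSum.atom (p : MSum M N) : Prop :=
  p ≠ MSum.bot M N ∧ ∀ q, MSum.sub M N q p → q = MSum.bot M N ∨ q = p

/-- The relation `◁` in `M ⊗ N`, where all of `M` comes before all of `N`. -/
def MSum.prec (p q : MSum M N) : Prop :=
  (p.1 ≠ bt M ∧ q.2 ≠ bt N) ∨ Prec p.1 q.1 ∨ Prec p.2 q.2

/-- The structure `M ⊗ N`. -/
instance : msoLang.Structure (MSum M N) where
  funMap f _ := match f with
    | MSOFunc.bot => MSum.bot M N
  RelMap R xs := match R, xs with
    | MSORel.sub, xs => MSum.sub M N (xs 0) (xs 1)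
    | MSORel.atom, xs => MSum.atom M N (xs 0)
    | MSORel.prec, xs => MSum.prec M N (xs 0) (xs 1)

end MSum

end PseudofiniteMSO

namespace PseudofiniteMSO

universe u v w

/-! ### Truth in `M ⊗ N` -/

section Decomposition

variable {α : Type} {n : ℕ}

/-! Two facts carry the theorem.

The first is a Feferman–Vaught decomposition. The universe of `M ⊗ N` is the full product `M × N`,
and each atomic formula holds on a finite union of rectangles, one factor speaking of `M` and the
other of `N`. Finite unions of rectangles are closed under complement and under projection along a
coordinate of the product, so every `φ` has a finite list `decomp φ` of pairs, depending on `φ`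
only, such that `φ` holds in `M ⊗ N` iff some pair holds componentwise (`realize_decomp`). Hence
`Th(M ⊗ N)` depends only on the two theories, and the preimage of a basic clopen set under `⊗` is a
finite union of clopen rectangles, so `⊗` is continuous. Applied with parameters, the same
decomposition gives comprehension in `M ⊗ N`, the one axiom of `T_MSO(Fin)` that is not a direct
check.

The second is cutting and gluing. In `M ⊗ N` the element `(⊤, ⊥)` is downward closed and cuts out
copies of `M` and `N`; conversely a model with a downward closed `X` is the sum of its restrictions
to `X` and to the complement. So the models of `φ + ψ` are, up to isomorphism, the sums of a model
of `φ` and a model of `ψ`, and `⊗` maps `⟨φ⟩ × ⟨ψ⟩` onto `⟨φ + ψ⟩` (`sumF_mem_otimes`,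
`exists_eq_otimes`).

Together they give the duality. If `φ ∈ x ⊗ y`, some pair `(p₁, p₂)` of `decomp φ` has `p₁ ∈ x` and
`p₂ ∈ y`, and `[p₁] + [p₂] ≤ [φ]` (`mk_sumF_le`). Thus `x ⊗ y` contains all sums from `x` and `y`,
and each of its elements lies above such a sum. It is therefore the filter they generate, and by
maximality the only prime filter containing them. The identification of completions with prime
filters is the compactness theorem. -/

/-- The negation of a finite disjunction of rectangles `φ ⊗ ψ`, as such a disjunction. -/
def negPairs : List (msoLang.BoundedFormula α n × msoLang.BoundedFormula α n) →
    List (msoLang.BoundedFormula α n × msoLang.BoundedFormula α n)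
  | [] => [(⊤, ⊤)]
  -- A point avoids the rectangle `q` iff its first coordinate fails `q.1` or its second fails
  -- `q.2`.
  | q :: l => (negPairs l).flatMap fun p => [(q.1.not ⊓ p.1, p.2), (p.1, q.2.not ⊓ p.2)]

/-- Pairs of formulas `(φᵢ, ψᵢ)` such that the given formula holds in `M ⊗ N` if and only if,
for some `i`, `φᵢ` holds in `M` and `ψᵢ` holds in `N`. -/
def decomp : {n : ℕ} → msoLang.BoundedFormula α n →
    List (msoLang.BoundedFormula α n × msoLang.BoundedFormula α n)
  | _, .falsum => []
  | _, .equal s t => [(.equal s t, .equal s t)]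
  | _, .rel R ts => match R, ts with
    | MSORel.sub, ts => [(.rel (L := msoLang) MSORel.sub ts, .rel (L := msoLang) MSORel.sub ts)]
    | MSORel.atom, ts =>
      [(.rel (L := msoLang) MSORel.atom ts,
          .equal (ts 0) (Constants.term (L := msoLang) MSOFunc.bot)),
        (.equal (ts 0) (Constants.term (L := msoLang) MSOFunc.bot),
          .rel (L := msoLang) MSORel.atom ts)]
    | MSORel.prec, ts =>
      [((BoundedFormula.equal (ts 0) (Constants.term (L := msoLang) MSOFunc.bot)).not,
          (BoundedFormula.equal (ts 1) (Constants.term (L := msoLang) MSOFunc.bot)).not),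
        (.rel (L := msoLang) MSORel.prec ts, ⊤), (⊤, .rel (L := msoLang) MSORel.prec ts)]
  | _, .imp φ ψ => negPairs (decomp φ) ++ decomp ψ
  -- Read `∀` as `¬∃¬`: a quantifier over pairs applied to a rectangle is one independent quantifier
  -- in each factor.
  | _, .all φ => negPairs ((negPairs (decomp φ)).map fun p => (p.1.ex, p.2.ex))

variable {M : Type v} {N : Type w}

/-- The first component of an element of `M ⊗ N`. -/
def MSum.fst (p : MSum M N) : M := Prod.fst (α := M) (β := N) p

/-- The second component of an element of `M ⊗ N`. -/
def MSum.snd (p : MSum M N) : N := Prod.snd (α := M) (β := N) p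

/-- The element of `M ⊗ N` with given components. -/
def MSum.pair (a : M) (c : N) : MSum M N := Prod.mk a c

@[simp] theorem MSum.fst_pair (a : M) (c : N) : (MSum.pair a c).fst = a := rfl

@[simp] theorem MSum.snd_pair (a : M) (c : N) : (MSum.pair a c).snd = c := rfl

theorem MSum.ext_iff {p q : MSum M N} : p = q ↔ p.fst = q.fst ∧ p.snd = q.snd := Prod.ext_iff

variable [msoLang.Structure M] [msoLang.Structure N]

/-- De Morgan: the complement of a union of rectangles is the intersection of the sets `(Aᶜ × N) ∪
(M × Bᶜ)`, and this intersection is distributed over the unions. -/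
theorem realize_negPairs
    (l : List (msoLang.BoundedFormula α n × msoLang.BoundedFormula α n))
    (e : α → M) (xs : Fin n → M) (e' : α → N) (xs' : Fin n → N) :
    (∃ p ∈ negPairs l, p.1.Realize e xs ∧ p.2.Realize e' xs') ↔
      ¬ ∃ p ∈ l, p.1.Realize e xs ∧ p.2.Realize e' xs' := by
  induction l with
  | nil => simp [negPairs]
  | cons q l ih =>
    rw [List.exists_mem_cons_iff, not_or, ← ih]
    constructor
    · rintro ⟨p, hp, h1, h2⟩
      obtain ⟨r, hr, hp⟩ := List.mem_flatMap.1 hp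
      simp only [List.mem_cons, List.not_mem_nil, or_false] at hp
      rcases hp with rfl | rfl
      · rw [BoundedFormula.realize_inf, BoundedFormula.realize_not] at h1
        exact ⟨fun h => h1.1 h.1, r, hr, h1.2, h2⟩
      · rw [BoundedFormula.realize_inf, BoundedFormula.realize_not] at h2
        exact ⟨fun h => h2.1 h.2, r, hr, h1, h2.2⟩
    · rintro ⟨h, r, hr, h1, h2⟩
      by_cases hq : q.1.Realize e xs
      · refine ⟨(r.1, q.2.not ⊓ r.2), List.mem_flatMap.2 ⟨r, hr, by simp⟩, h1, ?_⟩
        rw [BoundedFormula.realize_inf, BoundedFormula.realize_not]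
        exact ⟨fun h' => h ⟨hq, h'⟩, h2⟩
      · refine ⟨(q.1.not ⊓ r.1, r.2), List.mem_flatMap.2 ⟨r, hr, by simp⟩, ?_, h2⟩
        rw [BoundedFormula.realize_inf, BoundedFormula.realize_not]
        exact ⟨hq, h1⟩

theorem realize_botTerm {β : Type} (e : β → M) :
    (Constants.term (L := msoLang) MSOFunc.bot).realize e = bt M :=
  congrArg (Structure.funMap (L := msoLang) MSOFunc.bot) (Subsingleton.elim _ _)

@[simp] theorem MSum.fst_bt : (bt (MSum M N)).fst = bt M := rfl

@[simp] theorem MSum.snd_bt : (bt (MSum M N)).snd = bt N := rfl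

theorem MSum.sub_iff (p q : MSum M N) : Sub p q ↔ Sub p.fst q.fst ∧ Sub p.snd q.snd := Iff.rfl

theorem MSum.prec_iff (p q : MSum M N) :
    Prec p q ↔ (p.fst ≠ bt M ∧ q.snd ≠ bt N) ∨ Prec p.fst q.fst ∨ Prec p.snd q.snd := Iff.rfl

theorem MSum.atm_iff (hM : IsFinModel M) (hN : IsFinModel N) (p : MSum M N) :
    Atm p ↔ Atm p.fst ∧ p.snd = bt N ∨ p.fst = bt M ∧ Atm p.snd := by
  have h0 : Atm p ↔ p ≠ bt (MSum M N) ∧ ∀ q, Sub q p → q = bt (MSum M N) ∨ q = p := Iff.rfl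
  rw [h0, hM.atom, hN.atom]
  simp only [ne_eq, MSum.ext_iff, MSum.sub_iff, fst_bt, snd_bt]
  constructor
  · rintro ⟨h1, h2⟩
    -- The element `(p.fst, ⊥)` lies below `p`, so it is `⊥`, which makes the first coordinate
    -- trivial, or it is `p`, which makes the second trivial.
    rcases h2 (pair p.fst (bt N)) ⟨hM.refl _, hN.bot _⟩ with h3 | h3
    · refine Or.inr ⟨h3.1, fun hc => h1 ⟨h3.1, hc⟩, fun y hy => ?_⟩
      exact (h2 (pair p.fst y) ⟨hM.refl _, hy⟩).imp And.right And.right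
    · by_cases ha : p.fst = bt M
      · exact absurd ⟨ha, h3.2.symm⟩ h1
      · refine Or.inl ⟨⟨ha, fun y hy => ?_⟩, h3.2.symm⟩
        exact (h2 (pair y p.snd) ⟨hy, hN.refl _⟩).imp And.left And.left
  · rintro (⟨⟨h1, h2⟩, h3⟩ | ⟨h3, h1, h2⟩)
    · rw [h3]
      refine ⟨fun h => h1 h.1, fun q h => ?_⟩
      have hy : q.snd = bt N := hN.antisymm _ _ ⟨h.2, hN.bot _⟩
      exact (h2 _ h.1).imp (fun h => ⟨h, hy⟩) (fun h => ⟨h, hy⟩)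
    · rw [h3]
      refine ⟨fun h => h1 h.2, fun q h => ?_⟩
      have hx : q.fst = bt M := hM.antisymm _ _ ⟨h.1, hM.bot _⟩
      exact (h2 _ h.2).imp (fun h => ⟨hx, h⟩) (fun h => ⟨hx, h⟩)

/-- The only terms are variables and the constant, and both are evaluated componentwise. -/
theorem MSum.realize_term {β : Type} (e : β → MSum M N) (t : msoLang.Term β) :
    t.realize e =
      MSum.pair (t.realize fun i => (e i).fst) (t.realize fun i => (e i).snd) := by
  cases t with
  | var i => rfl
  | func f ts =>
    cases f
    refine Prod.ext ?_ ?_ <;>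
      exact congrArg (Structure.funMap (L := msoLang) MSOFunc.bot) (Subsingleton.elim _ _)

theorem sub_vec {M : Type u} [msoLang.Structure M] (xs : Fin 2 → M) :
    Structure.RelMap (L := msoLang) MSORel.sub xs ↔ Sub (xs 0) (xs 1) := by
  refine iff_of_eq (congrArg (Structure.RelMap (L := msoLang) MSORel.sub) ?_)
  funext i
  fin_cases i <;> rfl

theorem prec_vec {M : Type u} [msoLang.Structure M] (xs : Fin 2 → M) :
    Structure.RelMap (L := msoLang) MSORel.prec xs ↔ Prec (xs 0) (xs 1) := by
  refine iff_of_eq (congrArg (Structure.RelMap (L := msoLang) MSORel.prec) ?_)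
  funext i
  fin_cases i <;> rfl

theorem atm_vec {M : Type u} [msoLang.Structure M] (xs : Fin 1 → M) :
    Structure.RelMap (L := msoLang) MSORel.atom xs ↔ Atm (xs 0) := by
  refine iff_of_eq (congrArg (Structure.RelMap (L := msoLang) MSORel.atom) ?_)
  funext i
  fin_cases i
  rfl

/-- Truth in `M ⊗ N` reduces to truth in `M` and in `N`. -/
theorem realize_decomp (hM : IsFinModel M) (hN : IsFinModel N)
    (φ : msoLang.BoundedFormula α n) (e : α → MSum M N) (xs : Fin n → MSum M N) :
    φ.Realize e xs ↔ ∃ p ∈ decomp φ, p.1.Realize (fun i => (e i).fst) (fun i => (xs i).fst) ∧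
      p.2.Realize (fun i => (e i).snd) (fun i => (xs i).snd) := by
  have h1 : ∀ {m : ℕ} (xs : Fin m → MSum M N), (fun i => (Sum.elim e xs i).fst) =
      Sum.elim (fun i => (e i).fst) (fun i => (xs i).fst) := by
    intro m xs
    funext i
    rcases i with i | i <;> rfl
  have h2 : ∀ {m : ℕ} (xs : Fin m → MSum M N), (fun i => (Sum.elim e xs i).snd) =
      Sum.elim (fun i => (e i).snd) (fun i => (xs i).snd) := by
    intro m xs
    funext i
    rcases i with i | i <;> rfl
  induction φ with
  | falsum => simp [decomp, BoundedFormula.Realize]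
  | equal s t =>
    simp only [decomp, BoundedFormula.Realize, MSum.realize_term, h1, h2, List.mem_singleton,
      exists_eq_left]
    exact MSum.ext_iff
  | rel R ts =>
    cases R with
    | sub =>
      simp only [decomp, BoundedFormula.Realize, MSum.realize_term, h1, h2, List.mem_singleton,
        exists_eq_left, sub_vec]
      exact MSum.sub_iff _ _
    | atom =>
      simp only [decomp, BoundedFormula.Realize, MSum.realize_term, h1, h2, realize_botTerm,
        List.mem_cons, List.not_mem_nil, or_false, exists_eq_or_imp, exists_eq_left, atm_vec]
      exact MSum.atm_iff hM hN _
    | prec =>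
      simp only [decomp, List.mem_cons, List.not_mem_nil, or_false, exists_eq_or_imp,
        exists_eq_left, BoundedFormula.realize_not, BoundedFormula.realize_top, true_and,
        and_true]
      simp only [BoundedFormula.Realize, MSum.realize_term, h1, h2, realize_botTerm, prec_vec]
      exact MSum.prec_iff _ _
  | imp φ ψ ih1 ih2 =>
    refine (imp_congr (ih1 xs) (ih2 xs)).trans ?_
    rw [imp_iff_not_or, ← realize_negPairs]
    simp only [decomp, List.mem_append, or_and_right, exists_or]
  | @all m φ ih =>
    have h3 : ∀ a : MSum M N,
        (fun i => ((Fin.snoc xs a : Fin (m + 1) → MSum M N) i).fst) =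
          Fin.snoc (fun i => (xs i).fst) a.fst := by
      intro a
      funext i
      refine Fin.lastCases ?_ (fun j => ?_) i <;> simp
    have h4 : ∀ a : MSum M N,
        (fun i => ((Fin.snoc xs a : Fin (m + 1) → MSum M N) i).snd) =
          Fin.snoc (fun i => (xs i).snd) a.snd := by
      intro a
      funext i
      refine Fin.lastCases ?_ (fun j => ?_) i <;> simp
    have h5 : ∀ a : MSum M N, (¬ φ.Realize e (Fin.snoc xs a)) ↔ ∃ p ∈ negPairs (decomp φ),
        p.1.Realize (fun i => (e i).fst) (Fin.snoc (fun i => (xs i).fst) a.fst) ∧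
        p.2.Realize (fun i => (e i).snd) (Fin.snoc (fun i => (xs i).snd) a.snd) := by
      intro a
      refine (not_congr (ih (Fin.snoc xs a))).trans ?_
      rw [realize_negPairs, h3, h4]
    -- Removing the outer negation on both sides leaves the existence of a counterexample, which
    -- `h5` describes by rectangles.
    rw [decomp, realize_negPairs, BoundedFormula.realize_all, ← not_exists_not, not_iff_not]
    simp only [h5, List.mem_map, exists_exists_and_eq_and, BoundedFormula.realize_ex]
    constructor
    · rintro ⟨a, p, hp, ha, hc⟩
      exact ⟨p, hp, ⟨a.fst, ha⟩, ⟨a.snd, hc⟩⟩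
    -- Witnesses found separately in `M` and in `N` form a single witness because the universe is
    -- the full product.
    · rintro ⟨p, hp, ⟨a, ha⟩, ⟨c, hc⟩⟩
      exact ⟨MSum.pair a c, p, hp, ha, hc⟩

/-- The list on the right does not depend on the structures, so the theories of `M` and `N`
determine that of `M ⊗ N`. -/
theorem realize_sentence_decomp (hM : IsFinModel M) (hN : IsFinModel N)
    (φ : msoLang.Sentence) :
    MSum M N ⊨ φ ↔ ∃ p ∈ decomp φ, Sentence.Realize M p.1 ∧ Sentence.Realize N p.2 := by
  refine (realize_decomp hM hN φ default default).trans ?_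
  refine exists_congr fun p => and_congr_right fun _ => and_congr (iff_of_eq ?_) (iff_of_eq ?_)
  · exact congr (congrArg p.1.Realize (Subsingleton.elim _ _)) (Subsingleton.elim _ _)
  · exact congr (congrArg p.2.Realize (Subsingleton.elim _ _)) (Subsingleton.elim _ _)

end Decomposition

/-! ### Atoms in models of `T_MSO(Fin)` -/

section Atoms

variable {M : Type w} [msoLang.Structure M]

/-- Atoms are join-prime: by distributivity `a = (a ∧ x) ∨ (a ∧ y)`, and `a ∧ x` is either `⊥` or
`a`. -/
theorem IsFinModel.atm_sub_isSup (h : IsFinModel M) {x y z a : M} (hz : IsSup z x y)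
    (ha : Atm a) : Sub a z ↔ Sub a x ∨ Sub a y := by
  constructor
  · intro haz
    obtain ⟨q, hq⟩ := h.inf a x
    obtain ⟨r, hr⟩ := h.inf a y
    have hs := h.distrib a x y z a q r hz ⟨⟨h.refl _, haz⟩, fun _ ht => ht.1⟩ hq hr
    rcases ((h.atom a).1 ha).2 q hq.1.1 with h1 | h1
    · exact Or.inr (h.trans _ _ _ ⟨hs.2 r ⟨h1 ▸ h.bot r, h.refl r⟩, hr.1.2⟩)
    · exact Or.inl (h1 ▸ hq.1.2)
  · rintro (hax | hay)
    · exact h.trans _ _ _ ⟨hax, hz.1.1⟩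
    · exact h.trans _ _ _ ⟨hay, hz.1.2⟩

theorem IsFinModel.sub_isInf (h : IsFinModel M) {x y z t : M} (hz : IsInf z x y) :
    Sub t z ↔ Sub t x ∧ Sub t y :=
  ⟨fun ht => ⟨h.trans _ _ _ ⟨ht, hz.1.1⟩, h.trans _ _ _ ⟨ht, hz.1.2⟩⟩, hz.2 t⟩

/-- Inclusion is determined by the atoms. -/
theorem IsFinModel.sub_iff (h : IsFinModel M) {x y : M} :
    Sub x y ↔ ∀ a, Atm a → Sub a x → Sub a y := by
  refine ⟨fun hxy a _ hax => h.trans _ _ _ ⟨hax, hxy⟩, fun hxy => ?_⟩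
  obtain ⟨y', hy'⟩ := h.compl y
  obtain ⟨q, hq⟩ := h.inf x y'
  obtain ⟨r, hr⟩ := h.inf x y
  obtain ⟨j, hj⟩ := h.sup y y'
  -- Here `q = x ∧ yᶜ`. If it is `⊥`, then distributivity gives `x = x ∧ y`; otherwise it contains
  -- an atom of `x` that is not in `y`.
  by_cases hqb : q = bt M
  · have hs := h.distrib x y y' j x r q hj
      ⟨⟨h.refl _, hy'.2 _ hj.1 _⟩, fun _ ht => ht.1⟩ hr hq
    exact h.trans _ _ _ ⟨hs.2 r ⟨h.refl _, hqb ▸ h.bot _⟩, hr.1.2⟩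
  · obtain ⟨a, ha, haq⟩ := h.atomic q hqb
    rw [h.sub_isInf hq] at haq
    exact (h.not_both hy' ha (hxy a ha haq.1) haq.2).elim

theorem IsFinModel.ext_atm (h : IsFinModel M) {x y : M}
    (hxy : ∀ a, Atm a → (Sub a x ↔ Sub a y)) : x = y :=
  h.antisymm _ _ ⟨h.sub_iff.2 fun a ha => (hxy a ha).1, h.sub_iff.2 fun a ha => (hxy a ha).2⟩

theorem IsFinModel.not_sub_bt (h : IsFinModel M) {a : M} (ha : Atm a) : ¬ Sub a (bt M) :=
  fun hab => ((h.atom a).1 ha).1 (h.antisymm _ _ ⟨hab, h.bot a⟩)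

theorem IsFinModel.ne_bt_iff (h : IsFinModel M) {x : M} :
    x ≠ bt M ↔ ∃ a, Atm a ∧ Sub a x :=
  ⟨h.atomic x, fun ⟨_, ha, hax⟩ hx => h.not_sub_bt ha (hx ▸ hax)⟩

/-- The relation `◁` is witnessed by atoms, and `⊥` contains none. Atoms of `M ⊗ N` have one
coordinate `⊥`, so this and its mirror image leave at most one clause of `◁` between any two of
them. -/
theorem IsFinModel.not_prec_bt (h : IsFinModel M) {x : M} : ¬ Prec x (bt M) := by
  rw [h.prec]
  rintro ⟨a, _, c, hc, _, hcb, _⟩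
  exact h.not_sub_bt hc hcb

theorem IsFinModel.not_bt_prec (h : IsFinModel M) {x : M} : ¬ Prec (bt M) x := by
  rw [h.prec]
  rintro ⟨a, ha, c, _, hab, _⟩
  exact h.not_sub_bt ha hab

/-- A bijection between models of `T_MSO(Fin)` that preserves `⊆` and `◁` is an isomorphism. -/
def IsFinModel.equiv {N : Type v} [msoLang.Structure N] (hM : IsFinModel M) (hN : IsFinModel N)
    (e : M ≃ N) (hs : ∀ x y, Sub (e x) (e y) ↔ Sub x y)
    (hp : ∀ x y, Prec (e x) (e y) ↔ Prec x y) : M ≃[msoLang] N :=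
  -- Preserving `⊆` and `◁` suffices, since `⊥` and `At` are definable from `⊆`.
  have hb : e (bt M) = bt N := hN.antisymm _ _ ⟨by
    rw [← e.apply_symm_apply (bt N), hs]
    exact hM.bot _, hN.bot _⟩
  { toEquiv := e
    map_fun' := by
      intro n f xs
      cases f
      refine (congrArg e ?_).trans (hb.trans ?_) <;>
        exact congrArg (Structure.funMap (L := msoLang) MSOFunc.bot) (Subsingleton.elim _ _)
    map_rel' := by
      intro n R xs
      cases R with
      | sub => exact (sub_vec _).trans ((hs _ _).trans (sub_vec _).symm)
      | prec => exact (prec_vec _).trans ((hp _ _).trans (prec_vec _).symm)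
      | atom =>
        refine (atm_vec _).trans (Iff.trans ?_ (atm_vec _).symm)
        change Atm (e (xs 0)) ↔ _
        rw [hN.atom, hM.atom, ← hb]
        refine and_congr e.injective.ne_iff (e.forall_congr_right.symm.trans ?_)
        simp only [hs, e.injective.eq_iff] }

end Atoms

/-! ### `M ⊗ N` is a model -/

section Sum

variable {M : Type v} {N : Type w} [msoLang.Structure M] [msoLang.Structure N]

/-- The atoms of `M ⊗ N` are the `(a, ⊥)` and the `(⊥, c)`. With this lemma and its universal
counterpart, the order axioms for `M ⊗ N` become case distinctions on atoms of `M` and of `N`. -/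
theorem MSum.exists_atm_iff (hM : IsFinModel M) (hN : IsFinModel N) {P : MSum M N → Prop} :
    (∃ p, Atm p ∧ P p) ↔
      (∃ a, Atm a ∧ P (pair a (bt N))) ∨ ∃ c, Atm c ∧ P (pair (bt M) c) := by
  constructor
  · rintro ⟨p, hp, h⟩
    rcases (atm_iff hM hN p).1 hp with ⟨h1, h2⟩ | ⟨h1, h2⟩
    · exact Or.inl ⟨p.fst, h1, (MSum.ext_iff.2 ⟨rfl, h2⟩ : p = pair p.fst (bt N)) ▸ h⟩
    · exact Or.inr ⟨p.snd, h2, (MSum.ext_iff.2 ⟨h1, rfl⟩ : p = pair (bt M) p.snd) ▸ h⟩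
  · rintro (⟨a, ha, h⟩ | ⟨c, hc, h⟩)
    · exact ⟨pair a (bt N), (atm_iff hM hN _).2 (Or.inl ⟨ha, rfl⟩), h⟩
    · exact ⟨pair (bt M) c, (atm_iff hM hN _).2 (Or.inr ⟨rfl, hc⟩), h⟩

theorem MSum.forall_atm_iff (hM : IsFinModel M) (hN : IsFinModel N) {P : MSum M N → Prop} :
    (∀ p, Atm p → P p) ↔
      (∀ a, Atm a → P (pair a (bt N))) ∧ ∀ c, Atm c → P (pair (bt M) c) := by
  refine ⟨fun h => ⟨fun a ha => h _ ((atm_iff hM hN _).2 (Or.inl ⟨ha, rfl⟩)),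
    fun c hc => h _ ((atm_iff hM hN _).2 (Or.inr ⟨rfl, hc⟩))⟩, fun h p hp => ?_⟩
  rcases (atm_iff hM hN p).1 hp with ⟨h1, h2⟩ | ⟨h1, h2⟩
  · exact (MSum.ext_iff.2 ⟨rfl, h2⟩ : p = pair p.fst (bt N)) ▸ h.1 _ h1
  · exact (MSum.ext_iff.2 ⟨h1, rfl⟩ : p = pair (bt M) p.snd) ▸ h.2 _ h2

theorem MSum.isInf_iff (hM : IsFinModel M) (hN : IsFinModel N) (z x y : MSum M N) :
    IsInf z x y ↔ IsInf z.fst x.fst y.fst ∧ IsInf z.snd x.snd y.snd := by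
  constructor
  · rintro ⟨⟨h1, h2⟩, h3⟩
    refine ⟨⟨⟨h1.1, h2.1⟩, fun t ht => ?_⟩, ⟨⟨h1.2, h2.2⟩, fun t ht => ?_⟩⟩
    · exact (h3 (pair t (bt N)) ⟨⟨ht.1, hN.bot _⟩, ht.2, hN.bot _⟩).1
    · exact (h3 (pair (bt M) t) ⟨⟨hM.bot _, ht.1⟩, hM.bot _, ht.2⟩).2
  · rintro ⟨⟨h1, h2⟩, h3, h4⟩
    exact ⟨⟨⟨h1.1, h3.1⟩, h1.2, h3.2⟩, fun t ht => ⟨h2 _ ⟨ht.1.1, ht.2.1⟩, h4 _ ⟨ht.1.2, ht.2.2⟩⟩⟩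

theorem MSum.isSup_iff (z x y : MSum M N) :
    IsSup z x y ↔ IsSup z.fst x.fst y.fst ∧ IsSup z.snd x.snd y.snd := by
  constructor
  · rintro ⟨⟨h1, h2⟩, h3⟩
    refine ⟨⟨⟨h1.1, h2.1⟩, fun t ht => ?_⟩, ⟨⟨h1.2, h2.2⟩, fun t ht => ?_⟩⟩
    -- The other coordinate is filled with that of `z`, already known to be an upper bound there.
    · exact (h3 (pair t z.snd) ⟨⟨ht.1, h1.2⟩, ht.2, h2.2⟩).1
    · exact (h3 (pair z.fst t) ⟨⟨h1.1, ht.1⟩, h2.1, ht.2⟩).2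
  · rintro ⟨⟨h1, h2⟩, h3, h4⟩
    exact ⟨⟨⟨h1.1, h3.1⟩, h1.2, h3.2⟩, fun t ht => ⟨h2 _ ⟨ht.1.1, ht.2.1⟩, h4 _ ⟨ht.1.2, ht.2.2⟩⟩⟩

/-- At an atom `(a, ⊥)` the decomposition of `η` asks for a pair whose first formula holds at `a`
and whose second holds at `⊥` in `N`. The second condition does not involve `a`, so the disjunction
of the first formulas over the pairs that satisfy it is one formula about `a`, to which
comprehension in `M` applies. Atoms `(⊥, c)` are treated symmetrically in `N`, and the two sets
obtained form the required pair. -/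
theorem MSum.comprehension (hM : IsFinModel M) (hN : IsFinModel N) {k : ℕ}
    (η : msoLang.Formula (Fin k ⊕ Unit)) (ys : Fin k → MSum M N) : ∃ X : MSum M N,
    ∀ x, Atm x → (Sub x X ↔ η.Realize (Sum.elim ys fun _ => x)) := by
  classical
  have key : ∀ a c, η.Realize (Sum.elim ys fun _ => pair a c) ↔ ∃ p ∈ decomp η,
      Formula.Realize p.1 (Sum.elim (fun i => (ys i).fst) fun _ => a) ∧
      Formula.Realize p.2 (Sum.elim (fun i => (ys i).snd) fun _ => c) := by
    intro a c
    refine (realize_decomp hM hN η _ _).trans ?_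
    refine exists_congr fun p => and_congr_right fun _ => and_congr (iff_of_eq ?_) (iff_of_eq ?_)
    · refine congr (congrArg p.1.Realize ?_) (Subsingleton.elim _ _)
      funext i
      rcases i with i | i <;> rfl
    · refine congr (congrArg p.2.Realize ?_) (Subsingleton.elim _ _)
      funext i
      rcases i with i | i <;> rfl
  obtain ⟨X, hX⟩ := hM.comp ((((decomp η).filter fun p =>
    Formula.Realize p.2 (Sum.elim (fun i => (ys i).snd) fun _ => bt N)).map Prod.fst).foldr
      (· ⊔ ·) ⊥) fun i => (ys i).fst
  obtain ⟨Y, hY⟩ := hN.comp ((((decomp η).filter fun p =>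
    Formula.Realize p.1 (Sum.elim (fun i => (ys i).fst) fun _ => bt M)).map Prod.snd).foldr
      (· ⊔ ·) ⊥) fun i => (ys i).snd
  refine ⟨pair X Y, (forall_atm_iff hM hN).2 ⟨fun a ha => ?_, fun c hc => ?_⟩⟩
  · rw [key, sub_iff]
    refine (and_iff_left (hN.bot _)).trans ((hX a ha).trans ?_)
    refine (BoundedFormula.realize_foldr_sup _ _ _).trans ?_
    simp only [List.mem_map, List.mem_filter, decide_eq_true_eq]
    constructor
    · rintro ⟨_, ⟨p, ⟨hp, h2⟩, rfl⟩, h1⟩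
      exact ⟨p, hp, h1, h2⟩
    · rintro ⟨p, hp, h1, h2⟩
      exact ⟨_, ⟨p, ⟨hp, h2⟩, rfl⟩, h1⟩
  · rw [key, sub_iff]
    refine (and_iff_right (hM.bot _)).trans ((hY c hc).trans ?_)
    refine (BoundedFormula.realize_foldr_sup _ _ _).trans ?_
    simp only [List.mem_map, List.mem_filter, decide_eq_true_eq]
    constructor
    · rintro ⟨_, ⟨p, ⟨hp, h1⟩, rfl⟩, h2⟩
      exact ⟨p, hp, h1, h2⟩
    · rintro ⟨p, hp, h1, h2⟩
      exact ⟨_, ⟨p, ⟨hp, h1⟩, rfl⟩, h2⟩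

theorem MSum.ne_bt_iff {p : MSum M N} : p ≠ bt (MSum M N) ↔ p.fst ≠ bt M ∨ p.snd ≠ bt N := by
  rw [ne_eq, ext_iff, not_and_or]
  rfl

/-- The sum of two models of `T_MSO(Fin)` is again a model. -/
theorem IsFinModel.mSum (hM : IsFinModel M) (hN : IsFinModel N) : IsFinModel (MSum M N) where
  refl p := ⟨hM.refl _, hN.refl _⟩
  trans x y z h := ⟨hM.trans _ _ _ ⟨h.1.1, h.2.1⟩, hN.trans _ _ _ ⟨h.1.2, h.2.2⟩⟩
  antisymm x y h :=
    MSum.ext_iff.2 ⟨hM.antisymm _ _ ⟨h.1.1, h.2.1⟩, hN.antisymm _ _ ⟨h.1.2, h.2.2⟩⟩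
  bot y := ⟨hM.bot _, hN.bot _⟩
  top := by
    obtain ⟨s, hs⟩ := hM.top
    obtain ⟨t, ht⟩ := hN.top
    exact ⟨MSum.pair s t, fun y => ⟨hs _, ht _⟩⟩
  inf x y := by
    obtain ⟨s, hs⟩ := hM.inf x.fst y.fst
    obtain ⟨t, ht⟩ := hN.inf x.snd y.snd
    exact ⟨MSum.pair s t, (MSum.isInf_iff hM hN _ _ _).2 ⟨hs, ht⟩⟩
  sup x y := by
    obtain ⟨s, hs⟩ := hM.sup x.fst y.fst
    obtain ⟨t, ht⟩ := hN.sup x.snd y.snd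
    exact ⟨MSum.pair s t, (MSum.isSup_iff _ _ _).2 ⟨hs, ht⟩⟩
  distrib x y z j p q r := by
    simp only [MSum.isInf_iff hM hN, MSum.isSup_iff]
    intro h1 h2 h3 h4
    exact ⟨hM.distrib _ _ _ _ _ _ _ h1.1 h2.1 h3.1 h4.1,
      hN.distrib _ _ _ _ _ _ _ h1.2 h2.2 h3.2 h4.2⟩
  compl x := by
    obtain ⟨s, hs⟩ := hM.compl x.fst
    obtain ⟨t, ht⟩ := hN.compl x.snd
    refine ⟨MSum.pair s t, fun q hq => MSum.ext_iff.2 ⟨?_, ?_⟩, fun q hq r => ⟨?_, ?_⟩⟩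
    · exact hs.1 _ ⟨hq.1.1, hq.2.1⟩
    · exact ht.1 _ ⟨hq.1.2, hq.2.2⟩
    · exact hs.2 _ ⟨hq.1.1, hq.2.1⟩ _
    · exact ht.2 _ ⟨hq.1.2, hq.2.2⟩ _
  atom x := Iff.rfl
  atomic x hx := by
    rw [MSum.exists_atm_iff hM hN]
    refine (MSum.ne_bt_iff.1 hx).imp (fun h => ?_) (fun h => ?_)
    · obtain ⟨a, ha, hax⟩ := hM.atomic _ h
      exact ⟨a, ha, hax, hN.bot _⟩
    · obtain ⟨a, ha, hax⟩ := hN.atomic _ h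
      exact ⟨a, ha, hM.bot _, hax⟩
  irrefl := by
    simp only [MSum.forall_atm_iff hM hN, MSum.prec_iff, MSum.fst_pair, MSum.snd_pair, ne_eq,
      not_true_eq_false, and_false, false_and, false_or, hM.not_prec_bt, hN.not_prec_bt, or_false]
    exact ⟨hM.irrefl, hN.irrefl⟩
  ptrans := by
    simp only [MSum.forall_atm_iff hM hN, MSum.prec_iff, MSum.fst_pair, MSum.snd_pair, ne_eq,
      not_true_eq_false, and_false, false_and, false_or, hM.not_prec_bt, hN.not_prec_bt, or_false,
      hM.not_bt_prec, hN.not_bt_prec, false_imp_iff, implies_true, and_true, true_and]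
    have h1 : ∀ a : M, Atm a → a ≠ bt M := fun a ha => ((hM.atom a).1 ha).1
    have h2 : ∀ a : N, Atm a → a ≠ bt N := fun a ha => ((hN.atom a).1 ha).1
    exact ⟨fun a ha => ⟨fun c hc => ⟨fun d hd => hM.ptrans a ha c hc d hd,
      fun d hd _ => ⟨h1 a ha, h2 d hd⟩⟩, fun c hc d hd _ => ⟨h1 a ha, h2 d hd⟩⟩,
      hN.ptrans⟩
  total := by
    have h1 : ∀ a : M, Atm a → a ≠ bt M := fun a ha => ((hM.atom a).1 ha).1
    have h2 : ∀ a : N, Atm a → a ≠ bt N := fun a ha => ((hN.atom a).1 ha).1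
    simp only [MSum.forall_atm_iff hM hN, MSum.prec_iff, MSum.fst_pair, MSum.snd_pair, ne_eq,
      not_true_eq_false, and_false, false_and, false_or, hM.not_prec_bt, hN.not_prec_bt, or_false,
      hM.not_bt_prec, hN.not_bt_prec, MSum.ext_iff, and_true, true_and]
    exact ⟨fun a ha => ⟨fun c hc => hM.total a ha c hc, fun c hc => Or.inl ⟨h1 a ha, h2 c hc⟩⟩,
      fun c hc => ⟨fun a ha => Or.inr ⟨h1 a ha, h2 c hc⟩, fun d hd => hN.total c hc d hd⟩⟩
  prec x y := by
    have h1 : ∀ a : M, Atm a → a ≠ bt M := fun a ha => ((hM.atom a).1 ha).1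
    have h2 : ∀ a : N, Atm a → a ≠ bt N := fun a ha => ((hN.atom a).1 ha).1
    simp only [MSum.exists_atm_iff hM hN, MSum.prec_iff, MSum.sub_iff, MSum.fst_pair,
      MSum.snd_pair, ne_eq, not_true_eq_false, and_false, false_and, false_or, hM.not_prec_bt,
      hN.not_prec_bt, or_false, hM.not_bt_prec, hN.not_bt_prec, hM.bot, hN.bot, and_true,
      true_and, exists_false]
    -- Being different from `⊥` means containing an atom, so the clause `A ≠ ⊥ ∧ D ≠ ⊥` is the case
    -- of an atom of `M` against an atom of `N`.
    rw [hM.prec, hN.prec, ← ne_eq, ← ne_eq, hM.ne_bt_iff, hN.ne_bt_iff]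
    constructor
    · rintro (⟨⟨a, ha, hax⟩, c, hc, hcy⟩ | ⟨a, ha, hax⟩ | h)
      · exact Or.inl ⟨a, ha, Or.inr ⟨c, hc, hax, hcy, h1 a ha, h2 c hc⟩⟩
      · exact Or.inl ⟨a, ha, Or.inl hax⟩
      · exact Or.inr h
    · rintro (⟨a, ha, h | ⟨c, hc, hax, hcy, _⟩⟩ | h)
      · exact Or.inr (Or.inl ⟨a, ha, h⟩)
      · exact Or.inl ⟨⟨a, ha, hax⟩, c, hc, hcy⟩
      · exact Or.inr (Or.inr h)
  comp := MSum.comprehension hM hN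
  first := by
    intro h
    have h : (∃ a : M, Atm a) ∨ ∃ c : N, Atm c := by
      simpa using (MSum.exists_atm_iff hM hN (P := fun _ => True)).1 (by simpa using h)
    simp only [MSum.exists_atm_iff hM hN, MSum.forall_atm_iff hM hN, MSum.prec_iff,
      MSum.fst_pair, MSum.snd_pair, ne_eq, not_true_eq_false, and_false, false_and, false_or,
      hM.not_prec_bt, hN.not_prec_bt, or_false, hM.not_bt_prec, hN.not_bt_prec, not_false_eq_true,
      implies_true, and_true]
    -- The first atom is that of `M`, unless `M` has no atoms at all.
    by_cases hm : ∃ a : M, Atm a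
    · exact Or.inl (hM.first hm)
    · obtain ⟨c, hc, hmin⟩ := hN.first (h.resolve_left hm)
      exact Or.inr ⟨c, hc, fun a ha => (hm ⟨a, ha⟩).elim, hmin⟩
  last := by
    intro h
    have h : (∃ a : M, Atm a) ∨ ∃ c : N, Atm c := by
      simpa using (MSum.exists_atm_iff hM hN (P := fun _ => True)).1 (by simpa using h)
    simp only [MSum.exists_atm_iff hM hN, MSum.forall_atm_iff hM hN, MSum.prec_iff,
      MSum.fst_pair, MSum.snd_pair, ne_eq, not_true_eq_false, and_false, false_and, false_or,
      hM.not_prec_bt, hN.not_prec_bt, or_false, hM.not_bt_prec, hN.not_bt_prec, not_false_eq_true,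
      implies_true, true_and]
    by_cases hn : ∃ a : N, Atm a
    · exact Or.inr (hN.last hn)
    · obtain ⟨c, hc, hmin⟩ := hM.last (h.resolve_right hn)
      exact Or.inl ⟨c, hc, hmin, fun a ha => (hn ⟨a, ha⟩).elim⟩
  succ := by
    have h1 : ∀ a : M, Atm a → a ≠ bt M := fun a ha => ((hM.atom a).1 ha).1
    have h2 : ∀ a : N, Atm a → a ≠ bt N := fun a ha => ((hN.atom a).1 ha).1
    simp only [MSum.exists_atm_iff hM hN, MSum.forall_atm_iff hM hN, MSum.prec_iff,
      MSum.fst_pair, MSum.snd_pair, ne_eq, not_true_eq_false, and_false, false_and, false_or,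
      hM.not_prec_bt, hN.not_prec_bt, or_false, hM.not_bt_prec, hN.not_bt_prec, not_false_eq_true,
      implies_true, true_and, and_true, exists_false]
    refine ⟨fun a ha h => ?_, hN.succ⟩
    -- At the seam, the last atom of `M` is followed by the first atom of `N`.
    by_cases hm : ∃ c, Atm c ∧ Prec a c
    · exact Or.inl (hM.succ a ha hm)
    · obtain ⟨d, hd, -⟩ := h.resolve_left hm
      obtain ⟨c, hc, hmin⟩ := hN.first ⟨d, hd⟩
      exact Or.inr ⟨c, hc, ⟨h1 a ha, h2 c hc⟩, fun x hx hax => hm ⟨x, hx, hax.1⟩,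
        fun x hx hxc => hmin x hx hxc.2⟩
  pred := by
    have h1 : ∀ a : M, Atm a → a ≠ bt M := fun a ha => ((hM.atom a).1 ha).1
    have h2 : ∀ a : N, Atm a → a ≠ bt N := fun a ha => ((hN.atom a).1 ha).1
    simp only [MSum.exists_atm_iff hM hN, MSum.forall_atm_iff hM hN, MSum.prec_iff,
      MSum.fst_pair, MSum.snd_pair, ne_eq, not_true_eq_false, and_false, false_and, false_or,
      hM.not_prec_bt, hN.not_prec_bt, or_false, hM.not_bt_prec, hN.not_bt_prec, not_false_eq_true,
      implies_true, true_and, and_true, exists_false]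
    refine ⟨hM.pred, fun c hc h => ?_⟩
    by_cases hn : ∃ d, Atm d ∧ Prec d c
    · exact Or.inr (hN.pred c hc hn)
    · obtain ⟨d, hd, -⟩ := h.resolve_right hn
      obtain ⟨a, ha, hmax⟩ := hM.last ⟨d, hd⟩
      exact Or.inl ⟨a, ha, ⟨h1 a ha, h2 c hc⟩, fun x hx hax => hmax x hx hax.1,
        fun x hx hxc => hn ⟨x, hx, hxc.2⟩⟩
  least x hx := by
    simp only [MSum.exists_atm_iff hM hN, MSum.forall_atm_iff hM hN, MSum.prec_iff,
      MSum.sub_iff, hM.bot, hN.bot,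
      MSum.fst_pair, MSum.snd_pair, ne_eq, not_true_eq_false, and_false, false_and, false_or,
      hM.not_prec_bt, hN.not_prec_bt, or_false, hM.not_bt_prec, hN.not_bt_prec, false_imp_iff,
      implies_true, true_and, and_true]
    by_cases hm : x.fst = bt M
    · obtain ⟨c, hc, hcx, hmin⟩ := hN.least _ ((MSum.ne_bt_iff.1 hx).resolve_left (not_not.2 hm))
      exact Or.inr ⟨c, hc, hcx, fun a ha _ => hm ▸ hM.not_sub_bt ha, hmin⟩
    · exact Or.inl (hM.least _ hm)

/-! ### Cutting and gluing -/

/-- The initial part of `M ⊗ N` is isomorphic to `M`. -/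
theorem MSum.exists_dwcl (hM : IsFinModel M) (hN : IsFinModel N) :
    ∃ X Z : MSum M N, (Dwcl X ∧ IsComp X Z) ∧
      Nonempty (M ≃[msoLang] restr (hM.mSum hN).bot X) ∧
      Nonempty (N ≃[msoLang] restr (hM.mSum hN).bot Z) := by
  -- The cut is at `X = (⊤, ⊥)`, with complement `Z = (⊥, ⊤)`.
  obtain ⟨s, hs⟩ := hM.top
  obtain ⟨t, ht⟩ := hN.top
  have hX : Dwcl (pair s (bt N)) := by
    simp only [Dwcl, MSum.forall_atm_iff hM hN, MSum.prec_iff, MSum.sub_iff, MSum.fst_pair,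
      MSum.snd_pair, ne_eq, not_true_eq_false, and_false, false_and, false_or, hN.not_prec_bt, or_false,
      hM.not_bt_prec, hN.not_bt_prec, false_imp_iff, hN.bot, hs, implies_true, true_and]
    exact fun c hc d _ h => (hN.not_sub_bt hc h.1).elim
  have hc : IsComp (pair s (bt N)) (pair (bt M) t) := by
    refine ⟨fun q hq => MSum.ext_iff.2 ⟨?_, ?_⟩, fun q hq r => ⟨?_, ?_⟩⟩
    · exact hM.antisymm _ _ ⟨hq.2.1, hM.bot _⟩
    · exact hN.antisymm _ _ ⟨hq.1.2, hN.bot _⟩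
    · exact hM.trans _ _ _ ⟨hs _, hq.1.1⟩
    · exact hN.trans _ _ _ ⟨ht _, hq.2.2⟩
  obtain ⟨h1, h2⟩ := (hM.mSum hN).restr_dwcl hX hc
  refine ⟨_, _, ⟨hX, hc⟩, ⟨hM.equiv h1 ⟨fun a => ⟨pair a (bt N), hs a, hN.bot _⟩,
    fun p => (p : MSum M N).fst, fun a => rfl, fun p => Subtype.ext (MSum.ext_iff.2 ⟨rfl, ?_⟩)⟩
    ?_ ?_⟩, ⟨hN.equiv h2 ⟨fun a => ⟨pair (bt M) a, hM.bot _, ht a⟩,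
    fun p => (p : MSum M N).snd, fun a => rfl, fun p => Subtype.ext (MSum.ext_iff.2 ⟨?_, rfl⟩)⟩
    ?_ ?_⟩⟩
  · exact (hN.antisymm _ _ ⟨p.2.2, hN.bot _⟩).symm
  · intro x y
    exact (sub_coe ..).trans (and_iff_left (hN.bot _))
  · intro x y
    refine (prec_coe ..).trans ((prec_iff _ _).trans ?_)
    change x ≠ bt M ∧ bt N ≠ bt N ∨ Prec x y ∨ Prec (bt N) (bt N) ↔ _
    simp [hN.not_prec_bt]
  · exact (hM.antisymm _ _ ⟨p.2.1, hM.bot _⟩).symm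
  · intro x y
    exact (sub_coe ..).trans (and_iff_right (hM.bot _))
  · intro x y
    refine (prec_coe ..).trans ((prec_iff _ _).trans ?_)
    change bt M ≠ bt M ∧ y ≠ bt N ∨ Prec (bt M) (bt M) ∨ Prec x y ↔ _
    simp [hM.not_prec_bt]

/-- A model is the sum of its restrictions to a downward closed element and its complement. -/
theorem IsFinModel.nonempty_equiv_mSum (h : IsFinModel M) {X Z : M} (hX : Dwcl X)
    (hc : IsComp X Z) :
    Nonempty (M ≃[msoLang] MSum (restr h.bot X) (restr h.bot Z)) := by
  obtain ⟨h1, h2⟩ := h.restr_dwcl hX hc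
  choose f hf using fun x => h.inf x X
  choose g hg using fun x => h.inf x Z
  -- The isomorphism is `x ↦ (x ∧ X, x ∧ Z)`; its inverse takes a pair to the supremum.
  let e : M → MSum (restr h.bot X) (restr h.bot Z) := fun x =>
    MSum.pair ⟨f x, (hf x).1.2⟩ ⟨g x, (hg x).1.2⟩
  have hs : ∀ x y, Sub (e x) (e y) ↔ Sub x y := by
    intro x y
    rw [MSum.sub_iff, sub_coe, sub_coe]
    change Sub (f x) (f y) ∧ Sub (g x) (g y) ↔ _
    rw [h.sub_isInf (hf y), h.sub_isInf (hg y)]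
    constructor
    · rintro ⟨⟨h3, _⟩, h4, _⟩
      rw [h.sub_iff] at h3 h4 ⊢
      intro a ha hax
      rcases h.one_of hc ha with h5 | h5
      · exact h3 a ha ((hf x).2 a ⟨hax, h5⟩)
      · exact h4 a ha ((hg x).2 a ⟨hax, h5⟩)
    · intro hxy
      exact ⟨⟨h.trans _ _ _ ⟨(hf x).1.1, hxy⟩, (hf x).1.2⟩,
        h.trans _ _ _ ⟨(hg x).1.1, hxy⟩, (hg x).1.2⟩
  have he : Function.Bijective e := by
    constructor
    · intro x y hxy
      exact h.antisymm _ _ ⟨(hs _ _).1 (hxy ▸ (h1.mSum h2).refl _),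
        (hs _ _).1 (hxy ▸ (h1.mSum h2).refl _)⟩
    · intro p
      obtain ⟨s, hsup⟩ := h.sup (p.fst : M) p.snd
      refine ⟨s, MSum.ext_iff.2 ⟨Subtype.ext (h.ext_atm fun a ha => ?_),
        Subtype.ext (h.ext_atm fun a ha => ?_)⟩⟩
      · refine (h.sub_isInf (hf s)).trans ?_
        rw [h.atm_sub_isSup hsup ha]
        constructor
        · rintro ⟨h3 | h3, h4⟩
          · exact h3
          · exact (h.not_both hc ha h4 (h.trans _ _ _ ⟨h3, p.snd.2⟩)).elim
        · exact fun h3 => ⟨Or.inl h3, h.trans _ _ _ ⟨h3, p.fst.2⟩⟩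
      · refine (h.sub_isInf (hg s)).trans ?_
        rw [h.atm_sub_isSup hsup ha]
        constructor
        · rintro ⟨h3 | h3, h4⟩
          · exact (h.not_both hc ha (h.trans _ _ _ ⟨h3, p.fst.2⟩) h4).elim
          · exact h3
        · exact fun h3 => ⟨Or.inr h3, h.trans _ _ _ ⟨h3, p.snd.2⟩⟩
  refine ⟨h.equiv (h1.mSum h2) (Equiv.ofBijective e he) hs fun x y => ?_⟩
  refine (MSum.prec_iff (e x) (e y)).trans ?_
  rw [prec_coe, prec_coe, ne_eq, ne_eq, bt_coe_iff, bt_coe_iff, ← ne_eq, ← ne_eq]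
  change (f x ≠ bt M ∧ g y ≠ bt M) ∨ Prec (f x) (f y) ∨ Prec (g x) (g y) ↔ _
  simp only [h.ne_bt_iff, h.prec (f _), h.prec (g _), h.prec x, h.sub_isInf (hf _),
    h.sub_isInf (hg _)]
  -- What remains is to compare atoms. Since `X` is downward closed and disjoint from `Z`, every
  -- atom in `X` precedes every atom in `Z`; this matches the clause of `◁` that places the first
  -- summand before the second.
  constructor
  · rintro (⟨⟨a, ha, hax, haX⟩, c, hcc, hcy, hcZ⟩ | ⟨a, ha, c, hcc, hax, hcy, hac⟩ |
      ⟨a, ha, c, hcc, hax, hcy, hac⟩)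
    · refine ⟨a, ha, c, hcc, hax, hcy, ?_⟩
      rcases h.total a ha c hcc with h3 | rfl | h3
      · exact h3
      · exact (h.not_both hc ha haX hcZ).elim
      · exact (h.not_both hc hcc (hX a ha c hcc ⟨haX, h3⟩) hcZ).elim
    · exact ⟨a, ha, c, hcc, hax.1, hcy.1, hac⟩
    · exact ⟨a, ha, c, hcc, hax.1, hcy.1, hac⟩
  · rintro ⟨a, ha, c, hcc, hax, hcy, hac⟩
    rcases h.one_of hc ha with h3 | h3 <;> rcases h.one_of hc hcc with h4 | h4
    · exact Or.inr (Or.inl ⟨a, ha, c, hcc, ⟨hax, h3⟩, ⟨hcy, h4⟩, hac⟩)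
    · exact Or.inl ⟨⟨a, ha, hax, h3⟩, c, hcc, hcy, h4⟩
    · exact (h.not_both hc ha (hX c hcc a ha ⟨h4, hac⟩) h3).elim
    · exact Or.inr (Or.inr ⟨a, ha, c, hcc, ⟨hax, h3⟩, ⟨hcy, h4⟩, hac⟩)

/-- The sentence `φ + ψ` holds in `M ⊗ N` if `φ` holds in `M` and `ψ` holds in `N`. -/
theorem realize_sumF_mSum (hM : IsFinModel M) (hN : IsFinModel N) {φ ψ : msoLang.Sentence}
    (hφ : M ⊨ φ) (hψ : N ⊨ ψ) : MSum M N ⊨ sumF φ ψ := by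
  rw [realize_sumF (hM.mSum hN).bot]
  obtain ⟨X, Z, hXZ, ⟨e⟩, ⟨e'⟩⟩ := MSum.exists_dwcl hM hN
  exact ⟨X, Z, hXZ, (StrongHomClass.realize_sentence e φ).1 hφ,
    (StrongHomClass.realize_sentence e' ψ).1 hψ⟩

/-- The models of `φ + ψ` are the sums of a model of `φ` and a model of `ψ`. -/
theorem IsFinModel.exists_of_realize_sumF (h : IsFinModel M) {φ ψ : msoLang.Sentence}
    (hM : M ⊨ sumF φ ψ) : ∃ A B : msoLang.Substructure M, IsFinModel A ∧ IsFinModel B ∧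
      A ⊨ φ ∧ B ⊨ ψ ∧ Nonempty (M ≃[msoLang] MSum A B) := by
  obtain ⟨X, Z, ⟨hX, hc⟩, hφ, hψ⟩ := (realize_sumF h.bot φ ψ).1 hM
  obtain ⟨h1, h2⟩ := h.restr_dwcl hX hc
  exact ⟨_, _, h1, h2, hφ, hψ, h.nonempty_equiv_mSum hX hc⟩

end Sum

/-! ### The space of completions of a theory -/

section Completions

variable {L : FirstOrder.Language.{u, v}} {T : L.Theory}

/-- The completion of `T` given by the complete theory of a model. -/
def Completion.of (T : L.Theory) (M : Type w) [L.Structure M] [Nonempty M] (h : M ⊨ T) :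
    Completion T :=
  ⟨L.completeTheory M, Theory.model_iff_subset_completeTheory.1 h, completeTheory.isMaximal L M⟩

theorem Completion.exists_realize (x : Completion T) :
    ∃ M : Theory.ModelType.{u, v, max u v} T, ∀ φ : L.Sentence, φ ∈ x.1 ↔ M ⊨ φ := by
  obtain ⟨N⟩ := x.2.2.1
  have : N ⊨ T := N.is_model.mono x.2.1
  exact ⟨Theory.ModelType.of T N, x.mem_iff N.is_model⟩

theorem Completion.not_mem_iff (x : Completion T) (φ : L.Sentence) :
    φ.not ∈ x.1 ↔ φ ∉ x.1 := by
  obtain ⟨M, hM⟩ := x.exists_realize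
  rw [hM, hM, Sentence.realize_not]

theorem Completion.inf_mem_iff (x : Completion T) (φ ψ : L.Sentence) :
    φ ⊓ ψ ∈ x.1 ↔ φ ∈ x.1 ∧ ψ ∈ x.1 := by
  obtain ⟨M, hM⟩ := x.exists_realize
  rw [hM, hM, hM, Sentence.realize_inf]

theorem Completion.sup_mem_iff (x : Completion T) (φ ψ : L.Sentence) :
    φ ⊔ ψ ∈ x.1 ↔ φ ∈ x.1 ∨ ψ ∈ x.1 := by
  obtain ⟨M, hM⟩ := x.exists_realize
  rw [hM, hM, hM, Sentence.realize_sup]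

theorem Completion.mk_mem_classes_iff (x : Completion T) (φ : L.Sentence) :
    LTAlg.mk T φ ∈ x.classes ↔ φ ∈ x.1 := by
  refine ⟨?_, fun h => ⟨φ, h, rfl⟩⟩
  rintro ⟨ψ, hψ, h⟩
  obtain ⟨M, hM⟩ := x.exists_realize
  rw [hM] at hψ ⊢
  exact (Theory.Iff.models_sentence_iff (LTAlg.mk_eq_mk.1 h)).1 hψ

/-- Completions are maximal: a sentence of `y` missing from `x` would have its negation in `x`,
hence in `y`. -/
theorem Completion.ext_subset {x y : Completion T} (h : ∀ φ ∈ x.1, φ ∈ y.1) : x = y :=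
  Subtype.ext (Set.Subset.antisymm h fun φ hφ => by
    by_contra hx
    exact (y.not_mem_iff φ).1 (h _ ((x.not_mem_iff φ).2 hx)) hφ)

/-- The set of completions containing a sentence. -/
def Completion.basicSet (T : L.Theory) (φ : L.Sentence) : Set (Completion T) := {x | φ ∈ x.1}

theorem Completion.compl_basicSet (φ : L.Sentence) :
    (basicSet T φ)ᶜ = basicSet T φ.not := by
  ext x
  exact (x.not_mem_iff φ).symm

theorem Completion.isOpen_basicSet (φ : L.Sentence) : IsOpen (basicSet T φ) :=
  TopologicalSpace.isOpen_generateFrom_of_mem ⟨φ, rfl⟩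

theorem Completion.isClopen_basicSet (φ : L.Sentence) : IsClopen (basicSet T φ) :=
  ⟨⟨compl_basicSet (T := T) φ ▸ isOpen_basicSet φ.not⟩, isOpen_basicSet φ⟩

theorem Completion.isTopologicalBasis_basicSet :
    TopologicalSpace.IsTopologicalBasis (Set.range (basicSet T)) where
  exists_subset_inter := by
    rintro _ ⟨φ, rfl⟩ _ ⟨ψ, rfl⟩ x hx
    exact ⟨_, ⟨φ ⊓ ψ, rfl⟩, (x.inf_mem_iff φ ψ).2 hx, fun y hy => (y.inf_mem_iff φ ψ).1 hy⟩
  sUnion_eq := by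
    refine Set.eq_univ_of_forall fun x => ⟨_, ⟨⊤, rfl⟩, ?_⟩
    obtain ⟨M, hM⟩ := x.exists_realize
    exact (hM _).2 (Sentence.realize_top M)
  eq_generateFrom := by
    refine congrArg TopologicalSpace.generateFrom ?_
    ext U
    exact exists_congr fun φ => eq_comm

/-- The clopen sets `⟨φ⟩` separate points. Both the Hausdorff property and total disconnectedness
follow. -/
instance Completion.instTotallySeparatedSpace : TotallySeparatedSpace (Completion T) := by
  rw [totallySeparatedSpace_iff_exists_isClopen]
  intro x y hxy
  by_contra! h
  exact hxy (ext_subset fun φ hφ => not_not.1 (h _ (isClopen_basicSet φ) hφ))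

/-- An ultrafilter `F` converges to `{φ | ⟨φ⟩ ∈ F}`. This theory is satisfiable by the compactness
theorem, because finite intersections of members of `F` are non-empty, and it decides every sentence
because `F` is an ultrafilter. -/
instance Completion.instCompactSpace : CompactSpace (Completion T) := by
  refine ⟨isCompact_iff_ultrafilter_le_nhds.2 fun F _ => ?_⟩
  have hF : T ⊆ {φ | basicSet T φ ∈ F} ∧ Theory.IsMaximal {φ | basicSet T φ ∈ F} := by
    refine ⟨fun φ hφ => F.mem_of_superset Filter.univ_mem fun x _ => x.2.1 hφ, ?_, fun φ => ?_⟩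
    · refine Theory.isSatisfiable_iff_isFinitelySatisfiable.2 fun T₀ hT₀ => ?_
      obtain ⟨x, hx⟩ := F.neBot.nonempty_of_mem ((Filter.biInter_finset_mem T₀).2 hT₀)
      exact x.2.2.1.mono (Set.mem_iInter₂.1 hx)
    · have := F.mem_or_compl_mem (basicSet T φ)
      rwa [compl_basicSet] at this
  let x : Completion T := ⟨_, hF⟩
  refine ⟨x, Set.mem_univ _,
    le_trans (le_iInf₂ ?_) (TopologicalSpace.nhds_generateFrom (a := x)).ge⟩
  rintro _ ⟨hφ, φ, rfl⟩
  exact Filter.le_principal_iff.2 hφ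

/-- The clopen sets of completions are those given by a single sentence. -/
theorem Completion.exists_eq_basicSet {A : Set (Completion T)} (hA : IsClopen A) :
    ∃ φ, A = basicSet T φ := by
  -- A clopen set is compact, hence a finite union of basic sets, and such a union is given by a
  -- disjunction.
  obtain ⟨s, hs, rfl⟩ := eq_finite_iUnion_of_isTopologicalBasis_of_isCompact_open _
    isTopologicalBasis_basicSet A hA.1.isCompact hA.2
  clear hA
  induction s, hs using Set.Finite.induction_on with
  | empty =>
    refine ⟨⊥, ?_⟩
    ext x
    obtain ⟨M, hM⟩ := x.exists_realize
    simp only [Set.mem_empty_iff_false, Set.iUnion_of_empty, Set.iUnion_empty, false_iff]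
    exact fun h => (hM _).1 h
  | @insert φ s _ _ ih =>
    obtain ⟨ψ, hψ⟩ := ih
    refine ⟨φ ⊔ ψ, ?_⟩
    rw [Set.biUnion_insert, hψ]
    ext x
    exact (x.sup_mem_iff φ ψ).symm

/-- The basic open sets on the two sides correspond, so only bijectivity needs logic. A prime filter
`F` comes from `{φ | [φ] ∈ F}`, whose satisfiability is again the compactness theorem. -/
theorem Completion.isHomeomorph_toStone : IsHomeomorph (Completion.toStone (T := T)) := by
  rw [isHomeomorph_iff_isEmbedding_surjective]
  refine ⟨⟨⟨?_⟩, ?_⟩, ?_⟩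
  · refine Eq.trans ?_ induced_generateFrom_eq.symm
    refine congrArg TopologicalSpace.generateFrom (Set.ext fun U => ?_)
    constructor
    · rintro ⟨φ, rfl⟩
      exact ⟨_, ⟨LTAlg.mk T φ, rfl⟩, Set.ext fun x => x.mk_mem_classes_iff φ⟩
    · rintro ⟨_, ⟨⟨φ⟩, rfl⟩, rfl⟩
      exact ⟨φ, Set.ext fun x => x.mk_mem_classes_iff φ⟩
  · intro x y hxy
    refine ext_subset fun φ hφ => (y.mk_mem_classes_iff φ).1 ?_
    have h1 : LTAlg.mk T φ ∈ x.toStone.1 := (x.mk_mem_classes_iff φ).2 hφ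
    rw [hxy] at h1
    exact h1
  · rintro ⟨F, hF⟩
    -- Primeness is given as the complement being an ideal: non-emptiness and downward closure put
    -- `⊥` in the complement, and directedness yields the disjunction property.
    have hbot : ⊥ ∉ F := by
      obtain ⟨a, ha⟩ := hF.compl_ideal.Nonempty
      exact hF.compl_ideal.IsLowerSet bot_le ha
    have hsup : ∀ a c, a ⊔ c ∈ F → a ∈ F ∨ c ∈ F := by
      intro a c hac
      by_contra! h
      obtain ⟨d, hd, had, hcd⟩ := hF.compl_ideal.Directed a h.1 c h.2
      exact hd (F.mem_of_le (sup_le had hcd) hac)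
    -- The element found is the meet of the classes of the sentences in `T₀`. It lies in `F`, so it
    -- is not `⊥` and has a model.
    have hmodel : ∀ T₀ : Finset L.Sentence, (∀ φ ∈ T₀, LTAlg.mk T φ ∈ F) →
        ∃ a ∈ F, ∀ M ∈ a.models, ∀ φ ∈ T₀, M ⊨ φ := by
      classical
      intro T₀
      induction T₀ using Finset.induction_on with
      | empty => exact fun _ => ⟨⊤, Order.PFilter.top_mem, by simp⟩
      | insert φ T₀ _ ih =>
        intro h
        obtain ⟨a, ha, ha'⟩ := ih fun ψ hψ => h ψ (Finset.mem_insert_of_mem hψ)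
        refine ⟨LTAlg.mk T φ ⊓ a, Order.PFilter.inf_mem (h φ (Finset.mem_insert_self _ _)) ha, ?_⟩
        intro M hM ψ hψ
        rcases Finset.mem_insert.1 hψ with rfl | hψ
        · exact (inf_le_left : LTAlg.mk T ψ ⊓ a ≤ _) hM
        · exact ha' M ((inf_le_right : LTAlg.mk T φ ⊓ a ≤ a) hM) ψ hψ
    refine ⟨⟨{φ | LTAlg.mk T φ ∈ F}, ?_, ?_, ?_⟩, ?_⟩
    · intro φ hφ
      have h1 : ⊤ ≤ LTAlg.mk T φ := fun M _ => M.is_model.realize_of_mem φ hφ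
      exact F.mem_of_le h1 Order.PFilter.top_mem
    · refine Theory.isSatisfiable_iff_isFinitelySatisfiable.2 fun T₀ hT₀ => ?_
      obtain ⟨a, ha, hm⟩ := hmodel T₀ hT₀
      have hne : a.models.Nonempty := by
        by_contra hne
        have h1 : a ≤ ⊥ := fun M hM => (hne ⟨M, hM⟩).elim
        exact hbot (F.mem_of_le h1 ha)
      obtain ⟨M, hM⟩ := hne
      have : M ⊨ (T₀ : L.Theory) := ⟨fun φ hφ => hm M hM φ hφ⟩
      exact Theory.Model.isSatisfiable M
    · intro φ
      refine hsup _ _ (F.mem_of_le (x := ⊤) (fun M _ => ?_) Order.PFilter.top_mem)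
      exact (Sentence.realize_sup M).2 (by
        rw [Sentence.realize_not]
        exact em _)
    · refine Subtype.ext (Order.PFilter.ext _ _ (Set.ext ?_))
      rintro ⟨φ⟩
      exact Completion.mk_mem_classes_iff _ φ

end Completions

/-! ### Sums of completions -/

section Otimes

theorem isFinModel_of_model (x : Completion TFin) {M : Type w} [msoLang.Structure M]
    (hM : M ⊨ x.1) : IsFinModel M :=
  model_TFin_iff.1 (hM.mono x.2.1)

/-- The completion `Th(M ⊗ N)`, for a model `M` of `x` and a model `N` of `y`. -/
noncomputable def otimes (x y : Completion TFin) : Completion TFin :=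
  have : Nonempty (MSum x.2.2.1.some y.2.2.1.some) := ⟨bt _⟩
  Completion.of TFin (MSum x.2.2.1.some y.2.2.1.some)
    (model_TFin_iff.2 ((isFinModel_of_model x x.2.2.1.some.is_model).mSum
      (isFinModel_of_model y y.2.2.1.some.is_model)))

/-- Membership in `x ⊗ y` is expressed through `x` and `y` alone, which frees later arguments from
the models chosen in `otimes`. -/
theorem mem_otimes_iff (x y : Completion TFin) (φ : msoLang.Sentence) :
    φ ∈ (otimes x y).1 ↔ ∃ p ∈ decomp φ, p.1 ∈ x.1 ∧ p.2 ∈ y.1 := by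
  refine (realize_sentence_decomp (isFinModel_of_model x x.2.2.1.some.is_model)
    (isFinModel_of_model y y.2.2.1.some.is_model) φ).trans ?_
  exact exists_congr fun p => and_congr_right fun _ =>
    and_congr (x.mem_iff x.2.2.1.some.is_model _).symm (y.mem_iff y.2.2.1.some.is_model _).symm

theorem otimes_eq (x y : Completion TFin) (M : Type v) (N : Type w) [msoLang.Structure M]
    [msoLang.Structure N] (hM : M ⊨ x.1) (hN : N ⊨ y.1) :
    (otimes x y).1 = msoLang.completeTheory (MSum M N) := by
  have : Nonempty M := ⟨bt M⟩
  have : Nonempty N := ⟨bt N⟩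
  ext φ
  rw [mem_otimes_iff, mem_completeTheory,
    realize_sentence_decomp (isFinModel_of_model x hM) (isFinModel_of_model y hN)]
  exact exists_congr fun p => and_congr_right fun _ =>
    and_congr (x.mem_iff hM _) (y.mem_iff hN _)

theorem sumF_mem_otimes {x y : Completion TFin} {φ ψ : msoLang.Sentence} (hφ : φ ∈ x.1)
    (hψ : ψ ∈ y.1) : sumF φ ψ ∈ (otimes x y).1 :=
  realize_sumF_mSum (isFinModel_of_model x x.2.2.1.some.is_model)
    (isFinModel_of_model y y.2.2.1.some.is_model) ((x.mem_iff x.2.2.1.some.is_model _).1 hφ)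
    ((y.mem_iff y.2.2.1.some.is_model _).1 hψ)

/-- Cut a model of `z` where `φ + ψ` says it can be cut, and take the theories of the two pieces. -/
theorem exists_eq_otimes {z : Completion TFin} {φ ψ : msoLang.Sentence}
    (h : sumF φ ψ ∈ z.1) : ∃ x y : Completion TFin, φ ∈ x.1 ∧ ψ ∈ y.1 ∧ z = otimes x y := by
  obtain ⟨K⟩ := z.2.2.1
  obtain ⟨A, B, hA, hB, hφ, hψ, ⟨e⟩⟩ := (isFinModel_of_model z K.is_model).exists_of_realize_sumF
    ((z.mem_iff K.is_model _).1 h)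
  have : Nonempty A := ⟨bt A⟩
  have : Nonempty B := ⟨bt B⟩
  refine ⟨Completion.of TFin A (model_TFin_iff.2 hA), Completion.of TFin B (model_TFin_iff.2 hB),
    hφ, hψ, Completion.ext_subset fun χ hχ => ?_⟩
  rw [otimes_eq _ _ A B model_completeTheory model_completeTheory, mem_completeTheory,
    ← StrongHomClass.realize_sentence e]
  exact (z.mem_iff K.is_model _).1 hχ

/-- A model of `p.1 + p.2` is a sum of a model of `p.1` and one of `p.2`, and each pair in `decomp
φ` is sufficient for `φ`. This is why single sums `[p.1] + [p.2]` already generate `x ⊗ y`. -/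
theorem mk_sumF_le {φ : msoLang.Sentence}
    {p : msoLang.BoundedFormula Empty 0 × msoLang.BoundedFormula Empty 0}
    (hp : p ∈ decomp φ) : LTAlg.mk TFin (sumF p.1 p.2) ≤ LTAlg.mk TFin φ := by
  intro K hK
  obtain ⟨A, B, hA, hB, h1, h2, ⟨e⟩⟩ :=
    (model_TFin_iff.1 K.is_model).exists_of_realize_sumF hK
  exact (StrongHomClass.realize_sentence e φ).2
    ((realize_sentence_decomp hA hB φ).2 ⟨p, hp, h1, h2⟩)

/-! ### Compatibility and duality -/

theorem continuous_otimes :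
    Continuous fun p : Completion TFin × Completion TFin => otimes p.1 p.2 := by
  refine continuous_generateFrom_iff.2 ?_
  rintro _ ⟨φ, rfl⟩
  have h : (fun p : Completion TFin × Completion TFin => otimes p.1 p.2) ⁻¹' {x | φ ∈ x.1} =
      ⋃ q ∈ {q | q ∈ decomp φ}, Completion.basicSet TFin q.1 ×ˢ Completion.basicSet TFin q.2 := by
    ext p
    simp only [Set.mem_iUnion, exists_prop]
    exact mem_otimes_iff p.1 p.2 φ
  rw [h]
  exact isOpen_biUnion fun q _ =>
    (Completion.isOpen_basicSet q.1).prod (Completion.isOpen_basicSet q.2)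

theorem isCompatible_otimes : IsCompatible fun x y z => z = otimes x y := by
  refine ⟨fun A B hA hB => ?_, fun z => ?_⟩
  · obtain ⟨φ, rfl⟩ := Completion.exists_eq_basicSet hA
    obtain ⟨ψ, rfl⟩ := Completion.exists_eq_basicSet hB
    convert Completion.isClopen_basicSet (T := TFin) (sumF φ ψ) using 1
    ext z
    constructor
    · rintro ⟨x, hx, y, hy, rfl⟩
      exact sumF_mem_otimes hx hy
    · intro hz
      obtain ⟨x, y, hx, hy, h⟩ := exists_eq_otimes hz
      exact ⟨x, hx, y, hy, h⟩
  -- Fibres of a continuous map into a Hausdorff space are closed.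
  · exact isClosed_eq continuous_const continuous_otimes

/-- By `realize_sumF`, `φ + ψ` asserts a cut with `φ` on one side and `ψ` on the other; `∃` and `∧`
distribute over `∨`, and `⊥` holds on no side. -/
theorem isNormalAdditive_plus : IsNormalAdditive plus := by
  have key : ∀ (φ ψ : msoLang.Sentence) (K : Theory.ModelType.{0, 0, 0} TFin),
      K ∈ (plus (LTAlg.mk TFin φ) (LTAlg.mk TFin ψ)).models ↔ ∃ X Z : K,
        (Dwcl X ∧ IsComp X Z) ∧ restr (model_TFin_iff.1 K.is_model).bot X ⊨ φ ∧
          restr (model_TFin_iff.1 K.is_model).bot Z ⊨ ψ :=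
    fun φ ψ K => realize_sumF (model_TFin_iff.1 K.is_model).bot φ ψ
  refine ⟨?_, ?_⟩
  · rintro ⟨φ⟩
    constructor <;> refine LTAlg.models_injective (Set.ext fun K => ?_)
    · exact (key φ ⊥ K).trans ⟨fun ⟨_, _, _, _, h⟩ => h.elim, fun h => h.elim⟩
    · exact (key ⊥ φ K).trans ⟨fun ⟨_, _, _, h, _⟩ => h.elim, fun h => h.elim⟩
  · rintro ⟨φ⟩ ⟨ψ⟩ ⟨χ⟩
    constructor <;> refine LTAlg.models_injective (Set.ext fun K => ?_)
    · refine (key (φ ⊔ ψ) χ K).trans (Iff.trans ?_ (Sentence.realize_sup K).symm)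
      refine Iff.trans ?_ (or_congr (key φ χ K) (key ψ χ K)).symm
      simp only [Sentence.realize_sup, or_and_right, and_or_left, exists_or]
    · refine (key φ (ψ ⊔ χ) K).trans (Iff.trans ?_ (Sentence.realize_sup K).symm)
      refine Iff.trans ?_ (or_congr (key φ ψ K) (key φ χ K)).symm
      simp only [Sentence.realize_sup, and_or_left, exists_or]

theorem lift_plus_subset_iff {x y : Completion TFin} {S : Set (LTAlg TFin)} :
    lift plus x.classes y.classes ⊆ S ↔
      ∀ φ ∈ x.1, ∀ ψ ∈ y.1, LTAlg.mk TFin (sumF φ ψ) ∈ S := by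
  rw [lift, Set.image2_subset_iff]
  constructor
  · exact fun h φ hφ ψ hψ => h _ ⟨φ, hφ, rfl⟩ _ ⟨ψ, hψ, rfl⟩
  · rintro h _ ⟨φ, hφ, rfl⟩ _ ⟨ψ, hψ, rfl⟩
    exact h φ hφ ψ hψ

theorem dualRel_plus_iff (x y z : Completion TFin) :
    DualRel plus x.toStone y.toStone z.toStone ↔ z = otimes x y := by
  refine (lift_plus_subset_iff (S := z.classes)).trans ?_
  simp only [Completion.mk_mem_classes_iff]
  constructor
  · intro h
    -- By maximality the inclusion `x ⊗ y ⊆ z` is enough.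
    refine (Completion.ext_subset fun φ hφ => ?_).symm
    obtain ⟨p, hp, h1, h2⟩ := (mem_otimes_iff x y φ).1 hφ
    obtain ⟨K, hK⟩ := z.exists_realize
    exact (hK φ).2 (mk_sumF_le hp ((hK _).1 (h _ h1 _ h2)))
  · rintro rfl φ hφ ψ hψ
    exact sumF_mem_otimes hφ hψ

theorem isFunctional_plus : IsFunctional plus := by
  have hb := (Completion.isHomeomorph_toStone (T := TFin)).bijective
  intro x y
  obtain ⟨x, rfl⟩ := hb.2 x
  obtain ⟨y, rfl⟩ := hb.2 y
  refine ⟨(otimes x y).toStone, (dualRel_plus_iff _ _ _).2 rfl, fun z hz => ?_⟩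
  obtain ⟨z, rfl⟩ := hb.2 z
  exact congrArg _ ((dualRel_plus_iff _ _ _).1 hz)

theorem filterGen_lift_plus (x y : Completion TFin) :
    filterGen (lift plus x.classes y.classes) = (otimes x y).classes := by
  ext a
  constructor
  · rintro ⟨F, hF, ha⟩
    have hsub := (lift_plus_subset_iff (S := (otimes x y).classes)).2 fun φ hφ ψ hψ =>
      ⟨_, sumF_mem_otimes hφ hψ, rfl⟩
    refine (otimes x y).toStone.1.mem_of_le ha ?_
    exact Finset.inf_induction (p := (· ∈ (otimes x y).toStone.1)) Order.PFilter.top_mem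
      (fun _ h _ h' => Order.PFilter.inf_mem h h') fun c hc => hsub (hF hc)
  · rintro ⟨φ, hφ, rfl⟩
    obtain ⟨p, hp, h1, h2⟩ := (mem_otimes_iff x y φ).1 hφ
    -- One sum suffices: the upward closure of the set of sums is already a filter.
    refine ⟨{LTAlg.mk TFin (sumF p.1 p.2)}, ?_, ?_⟩
    · rw [Finset.coe_singleton, Set.singleton_subset_iff]
      exact ⟨_, ⟨p.1, h1, rfl⟩, _, ⟨p.2, h2, rfl⟩, rfl⟩
    · rw [Finset.inf_singleton]
      exact mk_sumF_le hp

end Otimes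

end PseudofiniteMSO

theorem mainTheorem4 :
    -- `+` is a normal additive binary operation, so it has an extended Stone dual
    PseudofiniteMSO.IsNormalAdditive PseudofiniteMSO.plus ∧
    -- the space of completions is a Boolean space
    (CompactSpace (PseudofiniteMSO.Completion PseudofiniteMSO.TFin) ∧
      T2Space (PseudofiniteMSO.Completion PseudofiniteMSO.TFin) ∧
      TotallyDisconnectedSpace (PseudofiniteMSO.Completion PseudofiniteMSO.TFin)) ∧
    -- it is homeomorphic to the Stone dual of the Lindenbaum–Tarski algebra
    IsHomeomorph (PseudofiniteMSO.Completion.toStone (T := PseudofiniteMSO.TFin)) ∧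
    ∃ otimes : PseudofiniteMSO.Completion PseudofiniteMSO.TFin →
        PseudofiniteMSO.Completion PseudofiniteMSO.TFin →
        PseudofiniteMSO.Completion PseudofiniteMSO.TFin,
      -- `x ⊗ y` is the theory of `M ⊗ N` for any models `M` of `x` and `N` of `y`
      (∀ (x y : PseudofiniteMSO.Completion PseudofiniteMSO.TFin)
        (M : Type*) (N : Type*)
        [PseudofiniteMSO.msoLang.Structure M] [PseudofiniteMSO.msoLang.Structure N],
        M ⊨ x.1 → N ⊨ y.1 →
          (otimes x y).1 =
            PseudofiniteMSO.msoLang.completeTheory (PseudofiniteMSO.MSum M N)) ∧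
      -- the graph of `⊗` is a compatible ternary relation
      PseudofiniteMSO.IsCompatible (fun x y z => z = otimes x y) ∧
      -- under the homeomorphism it is the relation dual to `+`
      (∀ x y z : PseudofiniteMSO.Completion PseudofiniteMSO.TFin,
        PseudofiniteMSO.DualRel PseudofiniteMSO.plus x.toStone y.toStone z.toStone ↔
          z = otimes x y) ∧
      -- the extended Stone dual of `+` is functional
      PseudofiniteMSO.IsFunctional PseudofiniteMSO.plus ∧
      -- the filter generated by `x + y` is `x ⊗ y`
      ∀ x y : PseudofiniteMSO.Completion PseudofiniteMSO.TFin,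
        PseudofiniteMSO.filterGen
            (PseudofiniteMSO.lift PseudofiniteMSO.plus x.classes y.classes) =
          (otimes x y).classes := by
  exact ⟨PseudofiniteMSO.isNormalAdditive_plus,
    ⟨inferInstance, inferInstance, inferInstance⟩,
    PseudofiniteMSO.Completion.isHomeomorph_toStone,
    PseudofiniteMSO.otimes,
    fun x y M N _ _ hM hN => PseudofiniteMSO.otimes_eq x y M N hM hN,
    PseudofiniteMSO.isCompatible_otimes,
    PseudofiniteMSO.dualRel_plus_iff,
    PseudofiniteMSO.isFunctional_plus,
    PseudofiniteMSO.filterGen_lift_plus⟩
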